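/- Let $S=K[x_1,\dots,x_n]$ be the standard graded polynomial ring over a field $K$, let $d\ge 2$ and let $\mathbf t=(t_1,\dots,t_{d-1})$ be a tuple of non-negative integers. A monomial $u=x_{j_1}x_{j_2}\cdots x_{j_\ell}$ of $S$ with $1\le j_1\le\cdots\le j_\ell\le n$ and $\ell\le d$ is called $\mathbf t$-spread if $j_{k+1}-j_k\ge t_k$ for all $k=1,\dots,\ell-1$. Let $I\subseteq S$ be a $\mathbf t$-spread strongly stable ideal, that is, an ideal generated by $\mathbf t$-spread monomials such that for every $\mathbf t$-spread monomial $u\in I$ and all $j<i$ such that $x_i$ divides $u$ and $x_j(u/x_i)$ is $\mathbf t$-spread, one has $x_j(u/x_i)\in I$. Let $G(I)$ be the minimal set of monomial generators of $I$, let $G(I)_j$ be the set of its elements of degree $j$, and let $\max(u)$ be the largest $i$ such that $x_i$ divides the monomial $u$. Then $I$ has a minimal graded free resolution $\cdots\to F_1\to F_0\to I\to 0$ over $S$ (with each $F_i$ of finite rank), and in every such resolution the graded Betti numbers $\beta_{i,m}(I)$, defined by $F_i\cong\bigoplus_{m}S(-m)^{\beta_{i,m}(I)}$, satisfy $$\beta_{i,i+j}(I)=\sum_{u\in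 G(I)_j}\binom{\max(u)-1-\sum_{\ell=1}^{j-1}t_\ell}{i}\qquad\text{for all } i,j\ge 0.$$ (If $I=S$, then $G(I)=\{1\}$ and $\max(1)$ is not defined; in this case the upper entry of the binomial coefficient is read as $0$.) -/

import Mathlib

namespace VectorSpread

open MvPolynomial

/-- A monomial of `K[x_1, …, x_n]` is given by its exponent vector `u : Fin n →₀ ℕ`; the variable
`x_{a+1}` has index `a : Fin n`.  Such a monomial is spread of type
`t = (t_1, …, t_{d-1})` (here `t_{k+1} = t k`) if it is a product
`x_{j_1} ⋯ x_{j_ℓ}` with `j_1 ≤ ⋯ ≤ j_ℓ`, `ℓ ≤ d`, and `j_{k+1} - j_k ≥ t_k` for `1 ≤ k < ℓ`.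
The weakly increasing sequence `J` is determined by `u`. -/
def IsSpread {n d : ℕ} (t : Fin (d - 1) → ℕ) (u : Fin n →₀ ℕ) : Prop :=
  ∃ (ℓ : ℕ) (J : Fin ℓ → Fin n), Monotone J ∧ u = ∑ k, Finsupp.single (J k) 1 ∧ ℓ ≤ d ∧
    ∀ (k : Fin (d - 1)) (h : (k : ℕ) + 1 < ℓ),
      (J ⟨k, Nat.lt_of_succ_lt h⟩ : ℕ) + t k ≤ (J ⟨k + 1, h⟩ : ℕ)

/-- `I` is a monomial ideal generated by `t`-spread monomials. -/
def IsSpreadIdeal {K : Type*} [Field K] {n d : ℕ} (t : Fin (d - 1) → ℕ)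
    (I : Ideal (MvPolynomial (Fin n) K)) : Prop :=
  ∃ A : Set (Fin n →₀ ℕ), (∀ u ∈ A, IsSpread t u) ∧
    I = Ideal.span ((fun u => monomial u (1 : K)) '' A)

/-- `I` is a `t`-spread strongly stable ideal: it is a `t`-spread monomial ideal, and whenever
`u ∈ I` is a `t`-spread monomial, `j < i`, `x_i ∣ u` and `x_j (u / x_i)` is `t`-spread, then
`x_j (u / x_i) ∈ I`. -/
structure IsSpreadStronglyStable {K : Type*} [Field K] {n d : ℕ} (t : Fin (d - 1) → ℕ)
    (I : Ideal (MvPolynomial (Fin n) K)) : Prop where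
  isSpreadIdeal : IsSpreadIdeal t I
  stable : ∀ u : Fin n →₀ ℕ, IsSpread t u → monomial u (1 : K) ∈ I →
    ∀ i j : Fin n, j < i → u i ≠ 0 →
      IsSpread t (u - Finsupp.single i 1 + Finsupp.single j 1) →
      monomial (u - Finsupp.single i 1 + Finsupp.single j 1) (1 : K) ∈ I

/-- `G(I)`: the minimal monomial generators of a monomial ideal `I`, that is, the monomials in `I`
that are minimal with respect to divisibility. -/
def minGens {K : Type*} [Field K] {n : ℕ} (I : Ideal (MvPolynomial (Fin n) K)) :
    Set (Fin n →₀ ℕ) :=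
  {u | Minimal (fun v => monomial v (1 : K) ∈ I) u}

open scoped Classical in
/-- `G(I)_j`: the elements of `G(I)` of degree `j`, as a finite set. -/
noncomputable def minGensOfDegree {K : Type*} [Field K] {n : ℕ}
    (I : Ideal (MvPolynomial (Fin n) K)) (j : ℕ) : Finset (Fin n →₀ ℕ) :=
  (Finset.univ.finsuppAntidiag j).filter (fun u => u ∈ minGens I)

theorem mem_minGensOfDegree {K : Type*} [Field K] {n : ℕ}
    (I : Ideal (MvPolynomial (Fin n) K)) (j : ℕ) (u : Fin n →₀ ℕ) :
    u ∈ minGensOfDegree I j ↔ u ∈ minGens I ∧ u.degree = j := by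
  classical
  simp [minGensOfDegree, Finset.mem_finsuppAntidiag, Finsupp.degree_eq_sum, and_comm]

/-- `max(u)`: the largest `i ∈ {1, …, n}` such that `x_i` divides `u` (and `0` for `u = 1`). -/
def maxVar {n : ℕ} (u : Fin n →₀ ℕ) : ℕ :=
  u.support.sup (fun a => (a : ℕ) + 1)

/-- The partial sum `t_1 + ⋯ + t_{j-1}` (all of `t` is summed if `j > d`). -/
def partialSum {d : ℕ} (t : Fin (d - 1) → ℕ) (j : ℕ) : ℕ :=
  ∑ k ∈ Finset.univ.filter (fun k : Fin (d - 1) => (k : ℕ) + 1 < j), t k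

/-- `x` is homogeneous of degree `p` in the graded free module `⨁_l S(-deg l)`, whose `l`-th
standard basis vector has degree `deg l`. -/
def IsHomogeneousVec {K : Type*} [Field K] {n : ℕ} {ι : Type*} (deg : ι → ℕ) (p : ℕ)
    (x : ι → MvPolynomial (Fin n) K) : Prop :=
  ∀ l, ∀ m ∈ (x l).support, m.degree + deg l = p

/-- A minimal graded free resolution `⋯ → F_2 → F_1 → F_0 → I → 0` of a (homogeneous) ideal `I` of
the standard graded polynomial ring `S = K[x_1, …, x_n]`.  The module `F_i = ⨁_k S(-deg i k)` is
free of finite rank; the maps are homogeneous of degree zero; the complex is exact; and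
`d_{i+1}(F_{i+1}) ⊆ (x_1, …, x_n) F_i` for all `i ≥ 0`. -/
structure MinimalGradedFreeResolution {K : Type*} [Field K] {n : ℕ}
    (I : Ideal (MvPolynomial (Fin n) K)) where
  /-- the rank of `F_i` -/
  rank : ℕ → ℕ
  /-- the degrees of the basis elements of `F_i` -/
  deg : (i : ℕ) → Fin (rank i) → ℕ
  /-- the augmentation `F_0 → I ⊆ S` -/
  aug : (Fin (rank 0) → MvPolynomial (Fin n) K) →ₗ[MvPolynomial (Fin n) K] MvPolynomial (Fin n) K
  /-- the differential `F_{i+1} → F_i` -/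
  diff : (i : ℕ) → (Fin (rank (i + 1)) → MvPolynomial (Fin n) K) →ₗ[MvPolynomial (Fin n) K]
    (Fin (rank i) → MvPolynomial (Fin n) K)
  aug_homogeneous : ∀ k, (aug (Pi.single k 1)).IsHomogeneous (deg 0 k)
  diff_homogeneous : ∀ i k, IsHomogeneousVec (deg i) (deg (i + 1) k) (diff i (Pi.single k 1))
  range_aug : LinearMap.range aug = I
  exact_aug : Function.Exact (diff 0) aug
  exact_diff : ∀ i, Function.Exact (diff (i + 1)) (diff i)
  minimal : ∀ i x l, diff i x l ∈ Ideal.span (Set.range (X : Fin n → MvPolynomial (Fin n) K))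

/-- The exponent of `S(-j)` in `F_i`, i.e. the number of basis elements of `F_i` of degree `j`. -/
def MinimalGradedFreeResolution.betti {K : Type*} [Field K] {n : ℕ}
    {I : Ideal (MvPolynomial (Fin n) K)} (F : MinimalGradedFreeResolution I) (i j : ℕ) : ℕ :=
  (Finset.univ.filter (fun k => F.deg i k = j)).card

end VectorSpread

/-! The ideal has linear quotients. Order G(I) by degree and then by the sum of the indices of the
variables. For u = x_{j_1}⋯x_{j_ℓ} in G(I), the colon by u of the ideal of the earlier generators is
generated by the variables x_i with i in one of the intervals [1, j_1) and [j_k + t_k, j_{k+1}).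
These are disjoint, and their lengths telescope to max(u) - 1 - ∑ t_k.

Such an x_i belongs to the colon because replacing j_{k+1} by i keeps the monomial spread and in I.
Conversely, let g ≠ u be an earlier generator. If the sequence of g falls below that of u somewhere,
the first such term of g is an i in a gap, and x_i has a larger exponent in g (`exists_mem_gapSet`).
Otherwise g can be lowered to a prefix of u (`mem_of_le`); minimality of u makes the prefix all of
u, and the order then forces g = u.

Adding u forms the mapping cone of multiplication by u on the resolution of the colon ideal
(`HasBetti.sup_span`). With r variables in the colon, this adds binom(r, i) basis elements of degree
i + deg u to F_i. The cone is minimal because the comparison map has no constant entries, for degree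
reasons. That every minimal resolution has the same Betti numbers follows by comparing two of them
modulo the variables (`GradedRes.betti_le`). -/

namespace VectorSpread

open MvPolynomial

/-! ### Homogeneous maps and lifts between graded free modules -/

section Graded

variable {K : Type*} [Field K] {n : ℕ} {ι κ μ : Type*}

/-- The homogeneous component of degree `p` in the graded free module `⨁_l S(-deg l)`. -/
noncomputable def component (deg : ι → ℕ) (p : ℕ) :
    (ι → MvPolynomial (Fin n) K) →ₗ[K] (ι → MvPolynomial (Fin n) K) :=
  LinearMap.pi fun l =>
    if deg l ≤ p then (homogeneousComponent (p - deg l)) ∘ₗ LinearMap.proj l else 0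

theorem coeff_component (deg : ι → ℕ) (p : ℕ) (x : ι → MvPolynomial (Fin n) K) (l : ι)
    (m : Fin n →₀ ℕ) :
    coeff m (component deg p x l) = if m.degree + deg l = p then coeff m (x l) else 0 := by
  unfold component
  rw [LinearMap.pi_apply]
  by_cases h : deg l ≤ p
  · rw [if_pos h]
    simp only [LinearMap.comp_apply, LinearMap.proj_apply, coeff_homogeneousComponent]
    congr 1
    simp only [eq_iff_iff]
    omega
  · rw [if_neg h, if_neg (by omega)]
    simp

theorem isHomogeneousVec_component (deg : ι → ℕ) (p : ℕ) (x : ι → MvPolynomial (Fin n) K) :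
    IsHomogeneousVec deg p (component deg p x) := by
  intro l m hm
  rw [mem_support_iff, coeff_component] at hm
  by_contra h
  exact hm (if_neg h)

theorem IsHomogeneousVec.component_eq {deg : ι → ℕ} {q : ℕ} {x : ι → MvPolynomial (Fin n) K}
    (hx : IsHomogeneousVec deg q x) (p : ℕ) :
    component deg p x = if q = p then x else 0 := by
  funext l
  ext m
  rw [coeff_component]
  by_cases hm : coeff m (x l) = 0
  · split_ifs <;> simp [hm]
  · rw [hx l m (mem_support_iff.2 hm)]
    split_ifs <;> simp

theorem IsHomogeneousVec.monomial_smul {deg : ι → ℕ} {q : ℕ} {x : ι → MvPolynomial (Fin n) K}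
    (hx : IsHomogeneousVec deg q x) (m : Fin n →₀ ℕ) (c : K) :
    IsHomogeneousVec deg (m.degree + q) (monomial m c • x) := by
  intro l m' hm'
  rw [mem_support_iff, Pi.smul_apply, smul_eq_mul, coeff_monomial_mul'] at hm'
  split_ifs at hm' with h
  · have := hx l (m' - m) (mem_support_iff.2 (right_ne_zero_of_mul hm'))
    obtain ⟨e, rfl⟩ := exists_add_of_le h
    rw [add_tsub_cancel_left] at this
    rw [map_add]
    omega
  · exact absurd rfl hm'

theorem isHomogeneousVec_single [DecidableEq ι] (deg : ι → ℕ) (k : ι) :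
    IsHomogeneousVec deg (deg k) (Pi.single k (1 : MvPolynomial (Fin n) K)) := by
  intro l m hm
  by_cases h : l = k
  · subst h
    rw [Pi.single_eq_same, mem_support_iff, coeff_one] at hm
    have : 0 = m := by
      by_contra h
      exact hm (if_neg h)
    simp [← this]
  · rw [Pi.single_eq_of_ne h] at hm
    simp at hm

/-- Both sides are K-linear, so it suffices to compare them on monomial multiples of basis vectors,
which are homogeneous. -/
theorem map_component [Fintype ι] [DecidableEq ι] {dι : ι → ℕ} {dκ : κ → ℕ} {a : ℕ}
    (D : (ι → MvPolynomial (Fin n) K) →ₗ[MvPolynomial (Fin n) K] (κ → MvPolynomial (Fin n) K))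
    (hD : ∀ k, IsHomogeneousVec dκ (dι k + a) (D (Pi.single k 1)))
    (p : ℕ) (x : ι → MvPolynomial (Fin n) K) :
    D (component dι p x) = component dκ (p + a) (D x) := by
  suffices h : (D.restrictScalars K) ∘ₗ component dι p =
      component dκ (p + a) ∘ₗ (D.restrictScalars K) from LinearMap.congr_fun h x
  refine LinearMap.pi_ext' fun k => ?_
  refine MvPolynomial.linearMap_ext fun m => LinearMap.ext fun c => ?_
  have hs : (Pi.single k (monomial m c) : ι → MvPolynomial (Fin n) K) =
      monomial m c • Pi.single k 1 := by
    rw [← Pi.single_smul, smul_eq_mul, mul_one]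
  simp only [LinearMap.comp_apply, LinearMap.coe_single, LinearMap.restrictScalars_apply, hs]
  rw [((isHomogeneousVec_single dι k).monomial_smul m c).component_eq, map_smul,
    ((hD k).monomial_smul m c).component_eq]
  by_cases h : m.degree + dι k = p
  · rw [if_pos h, if_pos (by omega), map_smul]
  · rw [if_neg h, if_neg (by omega), map_zero]

theorem IsHomogeneousVec.map [Fintype ι] [DecidableEq ι] {dι : ι → ℕ} {dκ : κ → ℕ} {a : ℕ}
    {D : (ι → MvPolynomial (Fin n) K) →ₗ[MvPolynomial (Fin n) K] (κ → MvPolynomial (Fin n) K)}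
    (hD : ∀ k, IsHomogeneousVec dκ (dι k + a) (D (Pi.single k 1)))
    {p : ℕ} {x : ι → MvPolynomial (Fin n) K} (hx : IsHomogeneousVec dι p x) :
    IsHomogeneousVec dκ (p + a) (D x) := by
  have h := map_component D hD p x
  rw [hx.component_eq, if_pos rfl] at h
  rw [h]
  exact isHomogeneousVec_component _ _ _

/-- Projectivity of finite free modules; `P` carries a side condition, such as homogeneity, on the
images of the basis vectors. -/
theorem exists_comp_eq {R M N : Type*} [CommRing R] [AddCommGroup M] [Module R M]
    [AddCommGroup N] [Module R N] [Fintype ι] [DecidableEq ι]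
    (D : M →ₗ[R] N) (f : (ι → R) →ₗ[R] N) (P : ι → M → Prop)
    (h : ∀ k, ∃ y, P k y ∧ D y = f (Pi.single k 1)) :
    ∃ φ : (ι → R) →ₗ[R] M, (∀ k, P k (φ (Pi.single k 1))) ∧ D ∘ₗ φ = f := by
  choose y hP hy using h
  refine ⟨(Pi.basisFun R ι).constr R y, fun k => ?_, ?_⟩
  · have : (Pi.basisFun R ι).constr R y (Pi.single k 1) = y k := by
      rw [← Pi.basisFun_apply, Module.Basis.constr_basis]
    rw [this]
    exact hP k
  · refine (Pi.basisFun R ι).ext fun k => ?_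
    rw [LinearMap.comp_apply, Module.Basis.constr_basis, hy, Pi.basisFun_apply]

/-- Any preimage of a homogeneous vector can be replaced by its component of the right degree, since
`D` commutes with taking components. -/
theorem exists_homogeneous_lift [Fintype ι] [DecidableEq ι] [Fintype κ] [DecidableEq κ]
    {dκ : κ → ℕ} {dμ : μ → ℕ}
    (D : (κ → MvPolynomial (Fin n) K) →ₗ[MvPolynomial (Fin n) K] (μ → MvPolynomial (Fin n) K))
    (hD : ∀ k, IsHomogeneousVec dμ (dκ k) (D (Pi.single k 1)))
    (f : (ι → MvPolynomial (Fin n) K) →ₗ[MvPolynomial (Fin n) K] (μ → MvPolynomial (Fin n) K))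
    (p : ι → ℕ) (hf : ∀ k, IsHomogeneousVec dμ (p k) (f (Pi.single k 1)))
    (hr : ∀ k, f (Pi.single k 1) ∈ LinearMap.range D) :
    ∃ φ : (ι → MvPolynomial (Fin n) K) →ₗ[MvPolynomial (Fin n) K] (κ → MvPolynomial (Fin n) K),
      (∀ k, IsHomogeneousVec dκ (p k) (φ (Pi.single k 1))) ∧ D ∘ₗ φ = f := by
  refine exists_comp_eq D f (fun k y => IsHomogeneousVec dκ (p k) y) fun k => ?_
  obtain ⟨y, hy⟩ := hr k
  refine ⟨component dκ (p k) y, isHomogeneousVec_component _ _ _, ?_⟩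
  rw [map_component (a := 0) D hD, hy, add_zero, (hf k).component_eq, if_pos rfl]

end Graded

/-- Dependent choice, used to build chain maps degree by degree: `G` is the invariant that makes the
next lift possible, `R` the commutation relation. -/
theorem exists_dependent_seq {α : ℕ → Type*} (G : ∀ i, α i → Prop)
    (R : ∀ i, α i → α (i + 1) → Prop) (x₀ : α 0) (h₀ : G 0 x₀)
    (hs : ∀ i x, G i x → ∃ y, G (i + 1) y ∧ R i x y) :
    ∃ f : ∀ i, α i, f 0 = x₀ ∧ (∀ i, G i (f i)) ∧ ∀ i, R i (f i) (f (i + 1)) := by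
  choose y hy using hs
  let F : ∀ i, {x : α i // G i x} := fun i =>
    Nat.rec (motive := fun i => {x : α i // G i x}) ⟨x₀, h₀⟩
      (fun i x => ⟨y i x.1 x.2, (hy i x.1 x.2).1⟩) i
  exact ⟨fun i => (F i).1, rfl, fun i => (F i).2, fun i => (hy i (F i).1 (F i).2).2⟩

/-- A minimal graded free resolution of an ideal, with bases indexed by arbitrary finite types. -/
structure GradedRes {K : Type*} [Field K] {n : ℕ} (I : Ideal (MvPolynomial (Fin n) K)) where
  /-- the index type of the basis of `F_i` -/
  ι : ℕ → Type
  [fin : ∀ i, Fintype (ι i)]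
  [dec : ∀ i, DecidableEq (ι i)]
  /-- the degrees of the basis elements -/
  deg : (i : ℕ) → ι i → ℕ
  /-- the augmentation -/
  aug : (ι 0 → MvPolynomial (Fin n) K) →ₗ[MvPolynomial (Fin n) K] MvPolynomial (Fin n) K
  /-- the differential -/
  diff : (i : ℕ) → (ι (i + 1) → MvPolynomial (Fin n) K) →ₗ[MvPolynomial (Fin n) K]
    (ι i → MvPolynomial (Fin n) K)
  aug_homogeneous : ∀ k, (aug (Pi.single k 1)).IsHomogeneous (deg 0 k)
  diff_homogeneous : ∀ i k, IsHomogeneousVec (deg i) (deg (i + 1) k) (diff i (Pi.single k 1))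
  range_aug : LinearMap.range aug = I
  exact_aug : Function.Exact (diff 0) aug
  exact_diff : ∀ i, Function.Exact (diff (i + 1)) (diff i)
  minimal : ∀ i k l, constantCoeff (diff i (Pi.single k 1) l) = 0

attribute [instance] GradedRes.fin GradedRes.dec

/-! ### Comparison of minimal resolutions and invariance of Betti numbers -/

namespace GradedRes

variable {K : Type*} [Field K] {n : ℕ} {I L : Ideal (MvPolynomial (Fin n) K)}

/-- The number of basis elements of degree `j` in homological degree `i`. -/
def betti (R : GradedRes I) (i j : ℕ) : ℕ :=
  (Finset.univ.filter (fun k => R.deg i k = j)).card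

theorem aug_diff (R : GradedRes I) (x) : R.aug (R.diff 0 x) = 0 :=
  R.exact_aug.apply_apply_eq_zero x

theorem diff_diff (R : GradedRes I) (i : ℕ) (x) : R.diff i (R.diff (i + 1) x) = 0 :=
  (R.exact_diff i).apply_apply_eq_zero x

theorem mem_range_diff_zero (R : GradedRes I) {x} (hx : R.aug x = 0) :
    ∃ y, R.diff 0 y = x := (R.exact_aug x).1 hx

theorem mem_range_diff_succ (R : GradedRes I) {i : ℕ} {x} (hx : R.diff i x = 0) :
    ∃ y, R.diff (i + 1) y = x := (R.exact_diff i x).1 hx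

theorem aug_mem (R : GradedRes I) (x) : R.aug x ∈ I := by
  have h : R.aug x ∈ LinearMap.range R.aug := LinearMap.mem_range_self _ _
  rwa [R.range_aug] at h

theorem exists_aug_eq (R : GradedRes I) {f} (hf : f ∈ I) : ∃ x, R.aug x = f := by
  have h : f ∈ LinearMap.range R.aug := by rwa [R.range_aug]
  exact h

theorem mem_span_X_iff (f : MvPolynomial (Fin n) K) :
    f ∈ Ideal.span (Set.range (X : Fin n → MvPolynomial (Fin n) K)) ↔ constantCoeff f = 0 := by
  rw [← Set.image_univ, mem_ideal_span_X_image]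
  constructor
  · intro h
    by_contra h0
    obtain ⟨i, -, hi⟩ := h 0 (mem_support_iff.2 h0)
    exact hi rfl
  · intro h m hm
    by_contra h0
    push Not at h0
    have : m = 0 := Finsupp.ext fun i => h0 i (Set.mem_univ i)
    subst this
    exact mem_support_iff.1 hm h

/-- A homogeneous chain map lifting multiplication by a form `u` with `u L ⊆ I`. -/
theorem exists_chainMap (R : GradedRes I) (R' : GradedRes L) {u : MvPolynomial (Fin n) K} {a : ℕ}
    (hu : u.IsHomogeneous a) (hL : ∀ f ∈ L, u * f ∈ I) :
    ∃ φ : ∀ i, (R'.ι i → MvPolynomial (Fin n) K) →ₗ[MvPolynomial (Fin n) K]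
        (R.ι i → MvPolynomial (Fin n) K),
      (∀ i k, IsHomogeneousVec (R.deg i) (R'.deg i k + a) (φ i (Pi.single k 1))) ∧
      (∀ x, R.aug (φ 0 x) = u * R'.aug x) ∧
      ∀ i x, R.diff i (φ (i + 1) x) = φ i (R'.diff i x) := by
  -- S is treated as the free module on one generator of degree 0, so that the lifting lemma also
  -- applies to the augmentations.
  obtain ⟨φ₀, h₁, h₂⟩ := exists_homogeneous_lift (dκ := R.deg 0) (dμ := fun _ : Unit => 0)
    (LinearMap.pi fun _ => R.aug)
    (fun k _ m hm => by
      have := R.aug_homogeneous k (mem_support_iff.1 hm)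
      rw [Finsupp.degree_eq_weight_one]
      exact this)
    (LinearMap.pi fun _ => u • R'.aug) (fun k => R'.deg 0 k + a)
    (fun k _ m hm => by
      have := (hu.mul (R'.aug_homogeneous k)) (mem_support_iff.1 hm)
      rw [Finsupp.degree_eq_weight_one, add_zero, add_comm _ a]
      exact this)
    (fun k => by
      obtain ⟨x, hx⟩ := R.exists_aug_eq (hL _ (R'.aug_mem (Pi.single k 1)))
      exact ⟨x, by ext1; simpa using hx⟩)
  have h₃ : ∀ x, R.aug (φ₀ x) = u * R'.aug x := fun x =>
    congrFun (LinearMap.congr_fun h₂ x) ()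
  obtain ⟨φ, rfl, hG, hR⟩ := exists_dependent_seq
    (α := fun i => (R'.ι i → MvPolynomial (Fin n) K) →ₗ[MvPolynomial (Fin n) K]
      (R.ι i → MvPolynomial (Fin n) K))
    (fun i ψ => (∀ k, IsHomogeneousVec (R.deg i) (R'.deg i k + a) (ψ (Pi.single k 1))) ∧
      ∀ x, ψ (R'.diff i x) ∈ LinearMap.range (R.diff i))
    (fun i ψ ψ' => R.diff i ∘ₗ ψ' = ψ ∘ₗ R'.diff i) φ₀
    ⟨h₁, fun x => R.mem_range_diff_zero (by rw [h₃, R'.aug_diff, mul_zero])⟩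
    (fun i ψ hψ => by
      obtain ⟨ψ', hψ₁, hψ₂⟩ := exists_homogeneous_lift (R.diff i) (R.diff_homogeneous i)
        (ψ ∘ₗ R'.diff i) (fun k => R'.deg (i + 1) k + a)
        (fun k => (R'.diff_homogeneous i k).map hψ.1) (fun k => hψ.2 _)
      refine ⟨ψ', ⟨hψ₁, fun x => R.mem_range_diff_succ ?_⟩, hψ₂⟩
      have := LinearMap.congr_fun hψ₂ (R'.diff (i + 1) x)
      simpa [R'.diff_diff] using this)
  exact ⟨φ, fun i => (hG i).1, h₃, fun i x => LinearMap.congr_fun (hR i) x⟩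

/-- The matrix of constant coefficients of a map of free modules. -/
noncomputable def constMatrix {ι κ : Type*} [Fintype ι] [DecidableEq ι]
    (f : (ι → MvPolynomial (Fin n) K) →ₗ[MvPolynomial (Fin n) K] (κ → MvPolynomial (Fin n) K)) :
    Matrix κ ι K :=
  (LinearMap.toMatrix' f).map constantCoeff

theorem constMatrix_comp {ι κ μ : Type*} [Fintype ι] [DecidableEq ι] [Fintype κ] [DecidableEq κ]
    (g : (κ → MvPolynomial (Fin n) K) →ₗ[MvPolynomial (Fin n) K] (μ → MvPolynomial (Fin n) K))
    (f : (ι → MvPolynomial (Fin n) K) →ₗ[MvPolynomial (Fin n) K] (κ → MvPolynomial (Fin n) K)) :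
    constMatrix (g ∘ₗ f) = constMatrix g * constMatrix f := by
  unfold constMatrix
  rw [LinearMap.toMatrix'_comp, Matrix.map_mul]

theorem constMatrix_apply {ι κ : Type*} [Fintype ι] [DecidableEq ι]
    (f : (ι → MvPolynomial (Fin n) K) →ₗ[MvPolynomial (Fin n) K] (κ → MvPolynomial (Fin n) K))
    (l : κ) (k : ι) : constMatrix f l k = constantCoeff (f (Pi.single k 1) l) := by
  simp [constMatrix, LinearMap.toMatrix'_apply]

theorem constMatrix_diff (R : GradedRes I) (i : ℕ) : constMatrix (R.diff i) = 0 := by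
  ext l k
  rw [constMatrix_apply, R.minimal, Matrix.zero_apply]

theorem constMatrix_add {ι κ : Type*} [Fintype ι] [DecidableEq ι]
    (f g : (ι → MvPolynomial (Fin n) K) →ₗ[MvPolynomial (Fin n) K] (κ → MvPolynomial (Fin n) K)) :
    constMatrix (f + g) = constMatrix f + constMatrix g := by
  ext l k
  simp [constMatrix_apply]

/-- A chain endomorphism of a minimal resolution that lifts zero vanishes modulo the variables. -/
theorem constMatrix_eq_zero (R : GradedRes I)
    (θ : ∀ i, (R.ι i → MvPolynomial (Fin n) K) →ₗ[MvPolynomial (Fin n) K]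
        (R.ι i → MvPolynomial (Fin n) K))
    (h₀ : ∀ x, R.aug (θ 0 x) = 0) (h : ∀ i x, R.diff i (θ (i + 1) x) = θ i (R.diff i x)) (i : ℕ) :
    constMatrix (θ i) = 0 := by
  -- Only the part d s d = θ d of a null-homotopy is carried along: it makes θ - s d land in the
  -- kernel of d at the next stage, hence θ = d s' + s d, and both summands vanish modulo the
  -- variables.
  suffices H : ∃ s : (R.ι i → MvPolynomial (Fin n) K) →ₗ[MvPolynomial (Fin n) K]
      (R.ι (i + 1) → MvPolynomial (Fin n) K),
      (∀ x, R.diff i (s (R.diff i x)) = θ i (R.diff i x)) ∧ constMatrix (θ i) = 0 from H.choose_spec.2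
  induction i with
  | zero =>
    obtain ⟨s, -, hs⟩ := exists_comp_eq (R.diff 0) (θ 0) (fun _ _ => True) (fun k => by
      obtain ⟨y, hy⟩ := R.mem_range_diff_zero (h₀ (Pi.single k 1))
      exact ⟨y, trivial, hy⟩)
    refine ⟨s, fun x => LinearMap.congr_fun hs _, ?_⟩
    rw [← hs, constMatrix_comp, constMatrix_diff, Matrix.zero_mul]
  | succ i ih =>
    obtain ⟨s, hs, -⟩ := ih
    obtain ⟨s', -, hs'⟩ := exists_comp_eq (R.diff (i + 1)) (θ (i + 1) - s ∘ₗ R.diff i)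
      (fun _ _ => True) (fun k => by
        obtain ⟨y, hy⟩ := R.mem_range_diff_succ (i := i)
          (x := (θ (i + 1) - s ∘ₗ R.diff i) (Pi.single k 1)) (by simp [h, hs])
        exact ⟨y, trivial, hy⟩)
    refine ⟨s', fun x => ?_, ?_⟩
    · have := LinearMap.congr_fun hs' (R.diff (i + 1) x)
      simpa [R.diff_diff] using this
    · rw [eq_sub_iff_add_eq] at hs'
      rw [← hs', constMatrix_add, constMatrix_comp, constMatrix_comp, constMatrix_diff,
        constMatrix_diff, Matrix.zero_mul, Matrix.mul_zero, add_zero]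

theorem constMatrix_comp_eq_one (R R' : GradedRes I)
    (φ : ∀ i, (R.ι i → MvPolynomial (Fin n) K) →ₗ[MvPolynomial (Fin n) K]
        (R'.ι i → MvPolynomial (Fin n) K))
    (ψ : ∀ i, (R'.ι i → MvPolynomial (Fin n) K) →ₗ[MvPolynomial (Fin n) K]
        (R.ι i → MvPolynomial (Fin n) K))
    (hφ₀ : ∀ x, R'.aug (φ 0 x) = 1 * R.aug x) (hψ₀ : ∀ x, R.aug (ψ 0 x) = 1 * R'.aug x)
    (hφ : ∀ i x, R'.diff i (φ (i + 1) x) = φ i (R.diff i x))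
    (hψ : ∀ i x, R.diff i (ψ (i + 1) x) = ψ i (R'.diff i x)) (i : ℕ) :
    constMatrix (ψ i) * constMatrix (φ i) = 1 := by
  have h := R.constMatrix_eq_zero (fun i => ψ i ∘ₗ φ i - LinearMap.id)
    (fun x => by simp [hφ₀, hψ₀]) (fun i x => by simp [hφ, hψ]) i
  have h1 : ψ i ∘ₗ φ i = (ψ i ∘ₗ φ i - LinearMap.id) + LinearMap.id := by abel
  rw [← constMatrix_comp, h1, constMatrix_add, h, zero_add]
  simp [constMatrix]

/-- Comparison maps φ, ψ over the identity of I satisfy ψφ = 1 modulo the variables. As φ is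
homogeneous, its constant matrix is block diagonal by degree, so the degree j block has a left
inverse and at least as many rows as columns. -/
theorem betti_le (R R' : GradedRes I) (i j : ℕ) : R.betti i j ≤ R'.betti i j := by
  obtain ⟨φ, hφd, hφ₀, hφ⟩ := R'.exists_chainMap R (isHomogeneous_one (Fin n) K)
    (fun f hf => by rwa [one_mul])
  obtain ⟨ψ, -, hψ₀, hψ⟩ := R.exists_chainMap R' (isHomogeneous_one (Fin n) K)
    (fun f hf => by rwa [one_mul])
  have h1 := constMatrix_comp_eq_one R R' φ ψ hφ₀ hψ₀ hφ hψ i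
  have h2 : ∀ k l, R.deg i k ≠ R'.deg i l → constMatrix (φ i) l k = 0 := by
    intro k l hkl
    rw [constMatrix_apply]
    by_contra h
    have := hφd i k l 0 (mem_support_iff.2 h)
    simp at this
    exact hkl this.symm
  let A : Matrix {l // R'.deg i l = j} {k // R.deg i k = j} K :=
    (constMatrix (φ i)).submatrix Subtype.val Subtype.val
  let B : Matrix {k // R.deg i k = j} {l // R'.deg i l = j} K :=
    (constMatrix (ψ i)).submatrix Subtype.val Subtype.val
  have hBA : B * A = 1 := by
    ext ⟨k, hk⟩ ⟨k', hk'⟩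
    have h3 := Matrix.ext_iff.2 h1 k k'
    rw [Matrix.mul_apply, Matrix.one_apply] at h3
    rw [Matrix.mul_apply, Matrix.one_apply]
    simp only [Subtype.mk.injEq]
    rw [← h3]
    refine (Finset.sum_subtype (Finset.univ.filter fun l => R'.deg i l = j) (by simp)
      (fun l => constMatrix (ψ i) k l * constMatrix (φ i) l k')).symm.trans ?_
    refine Finset.sum_filter_of_ne fun l _ hl => ?_
    by_contra hlj
    exact hl (by rw [h2 k' l (by omega), mul_zero])
  have h4 := Matrix.rank_mul_le_right B A
  rw [hBA, Matrix.rank_one] at h4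
  have h5 := h4.trans (Matrix.rank_le_card_height A)
  simpa [betti, Fintype.card_subtype] using h5

theorem betti_eq (R R' : GradedRes I) (i j : ℕ) : R.betti i j = R'.betti i j :=
  le_antisymm (betti_le R R' i j) (betti_le R' R i j)

theorem constantCoeff_diff (R : GradedRes I) (i : ℕ) (x l) :
    constantCoeff (R.diff i x l) = 0 := by
  rw [← LinearMap.toMatrix'_mulVec (R.diff i) x]
  simp only [Matrix.mulVec, dotProduct, map_sum, map_mul, LinearMap.toMatrix'_apply]
  refine Finset.sum_eq_zero fun k _ => ?_
  have := R.minimal i k l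
  simp_all

/-- Any minimal graded free resolution, with its basis indices `Fin (rank i)`. -/
noncomputable def ofResolution (F : MinimalGradedFreeResolution I) : GradedRes I where
  ι i := Fin (F.rank i)
  deg := F.deg
  aug := F.aug
  diff := F.diff
  aug_homogeneous := F.aug_homogeneous
  diff_homogeneous := F.diff_homogeneous
  range_aug := F.range_aug
  exact_aug := F.exact_aug
  exact_diff := F.exact_diff
  minimal i _ l := (mem_span_X_iff _).1 (F.minimal i _ l)

theorem betti_ofResolution (F : MinimalGradedFreeResolution I) (i j : ℕ) :
    (ofResolution F).betti i j = F.betti i j := rfl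

theorem funLeft_single {A ι κ : Type*} [CommRing A] [DecidableEq ι] [DecidableEq κ] (e : ι ≃ κ)
    (k : κ) :
    LinearMap.funLeft A A e (Pi.single k 1) = Pi.single (e.symm k) 1 := by
  ext l
  simp [LinearMap.funLeft_apply, Pi.single_apply, Equiv.eq_symm_apply]

theorem funLeft_symm {A ι κ : Type*} [CommRing A] (e : ι ≃ κ) (x : ι → A) :
    LinearMap.funLeft A A e (LinearMap.funLeft A A e.symm x) = x := by
  ext l
  simp [LinearMap.funLeft_apply]

theorem funLeft_symm' {A ι κ : Type*} [CommRing A] (e : ι ≃ κ) (x : κ → A) :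
    LinearMap.funLeft A A e.symm (LinearMap.funLeft A A e x) = x := by
  ext l
  simp [LinearMap.funLeft_apply]

/-- Reindex the bases by `Fin (rank i)`. -/
noncomputable def toResolution (R : GradedRes I) : MinimalGradedFreeResolution I where
  rank i := Fintype.card (R.ι i)
  deg i k := R.deg i ((Fintype.equivFin (R.ι i)).symm k)
  aug := R.aug ∘ₗ LinearMap.funLeft _ _ (Fintype.equivFin (R.ι 0))
  diff i := LinearMap.funLeft _ _ (Fintype.equivFin (R.ι i)).symm ∘ₗ R.diff i ∘ₗ
    LinearMap.funLeft _ _ (Fintype.equivFin (R.ι (i + 1)))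
  aug_homogeneous k := by
    rw [LinearMap.comp_apply, funLeft_single]
    exact R.aug_homogeneous _
  diff_homogeneous i k := by
    rw [LinearMap.comp_apply, LinearMap.comp_apply, funLeft_single]
    exact fun l m hm => R.diff_homogeneous i _ _ m hm
  range_aug := by
    rw [LinearMap.range_comp_of_range_eq_top, R.range_aug]
    exact LinearMap.range_eq_top.2 fun x => ⟨_, funLeft_symm _ x⟩
  exact_aug := by
    intro x
    simp only [LinearMap.comp_apply, Set.mem_range]
    rw [R.exact_aug]
    constructor
    · rintro ⟨y, hy⟩
      exact ⟨LinearMap.funLeft _ _ (Fintype.equivFin (R.ι (0 + 1))).symm y, by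
        rw [funLeft_symm, hy, funLeft_symm']⟩
    · rintro ⟨y, rfl⟩
      exact ⟨_, (funLeft_symm _ _).symm⟩
  exact_diff i := by
    intro x
    simp only [LinearMap.comp_apply, Set.mem_range]
    rw [← (LinearMap.funLeft (MvPolynomial (Fin n) K) (MvPolynomial (Fin n) K)
      (Fintype.equivFin (R.ι i)).symm).map_zero,
      (Function.LeftInverse.injective (funLeft_symm (Fintype.equivFin (R.ι i)))).eq_iff,
      R.exact_diff]
    constructor
    · rintro ⟨y, hy⟩
      exact ⟨LinearMap.funLeft _ _ (Fintype.equivFin (R.ι (i + 1 + 1))).symm y, by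
        rw [funLeft_symm, hy, funLeft_symm']⟩
    · rintro ⟨y, rfl⟩
      exact ⟨_, (funLeft_symm _ _).symm⟩
  minimal i x l := (mem_span_X_iff _).2 (R.constantCoeff_diff i _ _)

end GradedRes

/-! ### Mapping cones of maps of free modules -/

section Block

variable {A ι κ μ ν ι' κ' : Type*} [CommRing A]

/-- The differential `(x, y) ↦ (f x + φ y, -g y)` of a mapping cone. -/
def coneMap (f : (ι → A) →ₗ[A] (μ → A)) (φ : (κ → A) →ₗ[A] (μ → A)) (g : (κ → A) →ₗ[A] (ν → A)) :
    (ι ⊕ κ → A) →ₗ[A] (μ ⊕ ν → A) where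
  toFun z := Sum.elim (f (z ∘ Sum.inl) + φ (z ∘ Sum.inr)) (-(g (z ∘ Sum.inr)))
  map_add' x y := by
    have h1 : (x + y) ∘ Sum.inl = x ∘ Sum.inl + y ∘ Sum.inl := rfl
    have h2 : (x + y) ∘ Sum.inr = x ∘ Sum.inr + y ∘ Sum.inr := rfl
    rw [h1, h2, map_add, map_add, map_add]
    ext (l | l)
    · simp only [Sum.elim_inl, Pi.add_apply]
      ring
    · simp only [Sum.elim_inr, Pi.add_apply, Pi.neg_apply]
      ring
  map_smul' c x := by
    have h1 : (c • x) ∘ Sum.inl = c • (x ∘ Sum.inl) := rfl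
    have h2 : (c • x) ∘ Sum.inr = c • (x ∘ Sum.inr) := rfl
    rw [h1, h2, map_smul, map_smul, map_smul]
    ext (l | l) <;> simp [mul_add]

theorem coneMap_elim (f : (ι → A) →ₗ[A] (μ → A)) (φ : (κ → A) →ₗ[A] (μ → A))
    (g : (κ → A) →ₗ[A] (ν → A)) (x : ι → A) (y : κ → A) :
    coneMap f φ g (Sum.elim x y) = Sum.elim (f x + φ y) (-(g y)) := rfl

theorem single_inl [DecidableEq ι] [DecidableEq κ] (k : ι) :
    (Pi.single (Sum.inl k) 1 : ι ⊕ κ → A) = Sum.elim (Pi.single k 1) (0 : κ → A) := by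
  ext (l | l) <;> simp [Pi.single_apply]

theorem single_inr [DecidableEq ι] [DecidableEq κ] (k : κ) :
    (Pi.single (Sum.inr k) 1 : ι ⊕ κ → A) = Sum.elim (0 : ι → A) (Pi.single k 1) := by
  ext (l | l) <;> simp [Pi.single_apply]

theorem exists_elim {A ι κ : Type*} (z : ι ⊕ κ → A) : ∃ x y, z = Sum.elim x y :=
  ⟨z ∘ Sum.inl, z ∘ Sum.inr, (Sum.elim_comp_inl_inr z).symm⟩

/-- If (x, y) is a cycle, then y = g y' by exactness of the second row, and x + φ y' is a cycle of
the first row, say f x'. Then (x', -y') maps to (x, y). -/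
theorem exact_coneMap {f : (ι → A) →ₗ[A] (μ → A)} {φ : (κ → A) →ₗ[A] (μ → A)}
    {g : (κ → A) →ₗ[A] (ν → A)} {f' : (μ → A) →ₗ[A] (ι' → A)} {φ' : (ν → A) →ₗ[A] (ι' → A)}
    {g' : (ν → A) →ₗ[A] (κ' → A)} (hf : Function.Exact f f') (hg : Function.Exact g g')
    (hφ : ∀ y, f' (φ y) = φ' (g y)) :
    Function.Exact (coneMap f φ g) (coneMap f' φ' g') := by
  intro z
  obtain ⟨x, y, rfl⟩ := exists_elim z
  rw [coneMap_elim]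
  constructor
  · intro h
    have h1 : f' x + φ' y = 0 := congrArg (· ∘ Sum.inl) h
    have h2 : -(g' y) = 0 := congrArg (· ∘ Sum.inr) h
    obtain ⟨y', rfl⟩ := (hg y).1 (neg_eq_zero.1 h2)
    obtain ⟨x', hx'⟩ := (hf (x + φ y')).1 (by rw [map_add, hφ, h1])
    refine ⟨Sum.elim x' (-y'), ?_⟩
    rw [coneMap_elim, hx', map_neg, map_neg, neg_neg, add_neg_cancel_right]
  · rintro ⟨w, hw⟩
    obtain ⟨x', y', rfl⟩ := exists_elim w
    rw [coneMap_elim] at hw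
    have h1 : f x' + φ y' = x := congrArg (· ∘ Sum.inl) hw
    have h2 : -(g y') = y := congrArg (· ∘ Sum.inr) hw
    subst h1 h2
    rw [map_add, hf.apply_apply_eq_zero, map_neg, map_neg, hg.apply_apply_eq_zero, hφ]
    ext (l | l) <;> simp

/-- The augmentation `(x, y) ↦ f x + y u` of a mapping cone. -/
def coneAug (f : (ι → A) →ₗ[A] A) (u : A) : (ι ⊕ Unit → A) →ₗ[A] A where
  toFun z := f (z ∘ Sum.inl) + z (Sum.inr ()) * u
  map_add' x y := by
    have h1 : (x + y) ∘ Sum.inl = x ∘ Sum.inl + y ∘ Sum.inl := rfl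
    rw [h1, map_add, Pi.add_apply]
    ring
  map_smul' c x := by
    have h1 : (c • x) ∘ Sum.inl = c • (x ∘ Sum.inl) := rfl
    rw [h1, map_smul, Pi.smul_apply]
    simp only [smul_eq_mul, RingHom.id_apply]
    ring

theorem coneAug_elim (f : (ι → A) →ₗ[A] A) (u : A) (x : ι → A) (y : Unit → A) :
    coneAug f u (Sum.elim x y) = f x + y () * u := rfl

theorem coneAug_single_inl [DecidableEq ι] (f : (ι → A) →ₗ[A] A) (u : A) (k : ι) :
    coneAug f u (Pi.single (Sum.inl k) 1) = f (Pi.single k 1) := by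
  rw [single_inl, coneAug_elim, Pi.zero_apply, zero_mul, add_zero]

theorem coneAug_single_inr [DecidableEq ι] (f : (ι → A) →ₗ[A] A) (u : A) (k : Unit) :
    coneAug f u (Pi.single (Sum.inr k) 1) = u := by
  rw [single_inr, coneAug_elim, f.map_zero, zero_add, Pi.single_eq_same, one_mul]

end Block

/-! ### The mapping cone as a minimal resolution of I + (u) -/

namespace GradedRes

variable {K : Type*} [Field K] {n : ℕ} {I L : Ideal (MvPolynomial (Fin n) K)}

/-- The index types of the mapping cone. -/
def coneIndex (R : GradedRes I) (R' : GradedRes L) : ℕ → Type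
  | 0 => R.ι 0 ⊕ Unit
  | i + 1 => R.ι (i + 1) ⊕ R'.ι i

instance (R : GradedRes I) (R' : GradedRes L) : ∀ i, Fintype (coneIndex R R' i)
  | 0 => inferInstanceAs (Fintype (R.ι 0 ⊕ Unit))
  | i + 1 => inferInstanceAs (Fintype (R.ι (i + 1) ⊕ R'.ι i))

instance (R : GradedRes I) (R' : GradedRes L) : ∀ i, DecidableEq (coneIndex R R' i)
  | 0 => inferInstanceAs (DecidableEq (R.ι 0 ⊕ Unit))
  | i + 1 => inferInstanceAs (DecidableEq (R.ι (i + 1) ⊕ R'.ι i))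

/-- The degrees of the basis elements of the mapping cone. -/
def coneDeg (R : GradedRes I) (R' : GradedRes L) (a : ℕ) : ∀ i, coneIndex R R' i → ℕ
  | 0 => Sum.elim (R.deg 0) (fun _ => a)
  | i + 1 => Sum.elim (R.deg (i + 1)) (fun k => R'.deg i k + a)

/-- The differentials of the mapping cone. -/
noncomputable def coneDiff (R : GradedRes I) (R' : GradedRes L)
    (φ : ∀ i, (R'.ι i → MvPolynomial (Fin n) K) →ₗ[MvPolynomial (Fin n) K]
        (R.ι i → MvPolynomial (Fin n) K)) :
    ∀ i, (coneIndex R R' (i + 1) → MvPolynomial (Fin n) K) →ₗ[MvPolynomial (Fin n) K]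
      (coneIndex R R' i → MvPolynomial (Fin n) K)
  | 0 => coneMap (R.diff 0) (φ 0) (LinearMap.pi fun _ : Unit => R'.aug)
  | i + 1 => coneMap (R.diff (i + 1)) (φ (i + 1)) (R'.diff i)

theorem isHomogeneousVec_elim {ι κ : Type*} {d : ι → ℕ} {e : κ → ℕ} {p : ℕ}
    {x : ι → MvPolynomial (Fin n) K} {y : κ → MvPolynomial (Fin n) K}
    (hx : IsHomogeneousVec d p x) (hy : IsHomogeneousVec e p y) :
    IsHomogeneousVec (Sum.elim d e) p (Sum.elim x y) := by
  rintro (l | l)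
  · exact hx l
  · exact hy l

theorem isHomogeneousVec_zero {ι : Type*} {d : ι → ℕ} {p : ℕ} :
    IsHomogeneousVec d p (0 : ι → MvPolynomial (Fin n) K) := by
  intro l m hm
  simp at hm

theorem isHomogeneousVec_neg {ι : Type*} {d : ι → ℕ} {p : ℕ} {x : ι → MvPolynomial (Fin n) K}
    (hx : IsHomogeneousVec d p x) : IsHomogeneousVec d p (-x) := by
  intro l m hm
  rw [Pi.neg_apply, support_neg] at hm
  exact hx l m hm

theorem isHomogeneousVec_coneMap {ι κ μ ν : Type*} [DecidableEq ι] [DecidableEq κ]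
    {f : (ι → MvPolynomial (Fin n) K) →ₗ[MvPolynomial (Fin n) K] (μ → MvPolynomial (Fin n) K)}
    {φ : (κ → MvPolynomial (Fin n) K) →ₗ[MvPolynomial (Fin n) K] (μ → MvPolynomial (Fin n) K)}
    {g : (κ → MvPolynomial (Fin n) K) →ₗ[MvPolynomial (Fin n) K] (ν → MvPolynomial (Fin n) K)}
    {dι : ι → ℕ} {dκ : κ → ℕ} {dμ : μ → ℕ} {dν : ν → ℕ}
    (hf : ∀ k, IsHomogeneousVec dμ (dι k) (f (Pi.single k 1)))
    (hφ : ∀ k, IsHomogeneousVec dμ (dκ k) (φ (Pi.single k 1)))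
    (hg : ∀ k, IsHomogeneousVec dν (dκ k) (g (Pi.single k 1))) (k : ι ⊕ κ) :
    IsHomogeneousVec (Sum.elim dμ dν) (Sum.elim dι dκ k) (coneMap f φ g (Pi.single k 1)) := by
  rcases k with k | k
  · rw [single_inl, coneMap_elim, φ.map_zero, g.map_zero, add_zero, neg_zero]
    exact isHomogeneousVec_elim (hf k) isHomogeneousVec_zero
  · rw [single_inr, coneMap_elim, f.map_zero, zero_add]
    exact isHomogeneousVec_elim (hφ k) (isHomogeneousVec_neg (hg k))

theorem constantCoeff_coneMap {ι κ μ ν : Type*} [DecidableEq ι] [DecidableEq κ]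
    {f : (ι → MvPolynomial (Fin n) K) →ₗ[MvPolynomial (Fin n) K] (μ → MvPolynomial (Fin n) K)}
    {φ : (κ → MvPolynomial (Fin n) K) →ₗ[MvPolynomial (Fin n) K] (μ → MvPolynomial (Fin n) K)}
    {g : (κ → MvPolynomial (Fin n) K) →ₗ[MvPolynomial (Fin n) K] (ν → MvPolynomial (Fin n) K)}
    (hf : ∀ k l, constantCoeff (f (Pi.single k 1) l) = 0)
    (hφ : ∀ k l, constantCoeff (φ (Pi.single k 1) l) = 0)
    (hg : ∀ k l, constantCoeff (g (Pi.single k 1) l) = 0) (k : ι ⊕ κ) (l : μ ⊕ ν) :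
    constantCoeff (coneMap f φ g (Pi.single k 1) l) = 0 := by
  rcases k with k | k
  · rw [single_inl, coneMap_elim, φ.map_zero, g.map_zero, add_zero, neg_zero]
    rcases l with l | l
    · exact hf k l
    · simp
  · rw [single_inr, coneMap_elim, f.map_zero, zero_add]
    rcases l with l | l
    · exact hφ k l
    · simp only [Sum.elim_inr, Pi.neg_apply, map_neg, hg, neg_zero]

theorem range_coneAug (R : GradedRes I) (u : MvPolynomial (Fin n) K) :
    LinearMap.range (coneAug R.aug u) = I ⊔ Ideal.span {u} := by
  ext f
  rw [LinearMap.mem_range, Submodule.mem_sup]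
  constructor
  · rintro ⟨z, rfl⟩
    exact ⟨_, R.aug_mem _, _, Ideal.mem_span_singleton'.2 ⟨_, rfl⟩, rfl⟩
  · rintro ⟨g, hg, h, hh, rfl⟩
    obtain ⟨x, rfl⟩ := R.exists_aug_eq hg
    obtain ⟨c, rfl⟩ := Ideal.mem_span_singleton'.1 hh
    exact ⟨Sum.elim x fun _ => c, rfl⟩

/-- The lowest-degree case of the cone argument: the relation f x + y u = 0 puts y in the colon
ideal L, which the augmentation of `R'` covers. -/
theorem exact_coneAug (R : GradedRes I) (R' : GradedRes L) {u : MvPolynomial (Fin n) K}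
    (hL : ∀ f, f * u ∈ I ↔ f ∈ L)
    (φ : (R'.ι 0 → MvPolynomial (Fin n) K) →ₗ[MvPolynomial (Fin n) K]
        (R.ι 0 → MvPolynomial (Fin n) K)) (hφ : ∀ x, R.aug (φ x) = u * R'.aug x) :
    Function.Exact (coneMap (R.diff 0) φ (LinearMap.pi fun _ : Unit => R'.aug))
      (coneAug R.aug u) := by
  intro z
  obtain ⟨x, y, rfl⟩ := exists_elim z
  rw [coneAug_elim]
  constructor
  · intro h
    have h1 : y () ∈ L := (hL _).1 (by
      rw [← neg_eq_iff_add_eq_zero] at h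
      rw [← h]
      exact I.neg_mem (R.aug_mem _))
    obtain ⟨y', hy'⟩ := R'.exists_aug_eq h1
    obtain ⟨x', hx'⟩ := R.mem_range_diff_zero (x := x + φ y') (by
      rw [map_add, hφ, hy', mul_comm, h])
    refine ⟨Sum.elim x' (-y'), ?_⟩
    rw [coneMap_elim, hx', map_neg, map_neg, neg_neg, add_neg_cancel_right]
    congr 1
    ext1
    exact hy'
  · rintro ⟨w, hw⟩
    obtain ⟨x', y', rfl⟩ := exists_elim w
    rw [coneMap_elim] at hw
    have h1 : R.diff 0 x' + φ y' = x := congrArg (· ∘ Sum.inl) hw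
    have h2 : -(R'.aug y') = y () := congrFun hw (Sum.inr ())
    rw [← h1, ← h2, map_add, R.aug_diff, hφ]
    ring

/-- The mapping cone of a lift of multiplication by `u`, as a resolution of `I + (u)`. -/
noncomputable def cone (R : GradedRes I) (R' : GradedRes L) {u : MvPolynomial (Fin n) K} {a : ℕ}
    (hu : u.IsHomogeneous a) (hL : ∀ f, f * u ∈ I ↔ f ∈ L) (hR : ∀ k, R'.deg 0 k ≠ 0)
    (hd : ∀ i k l, R'.deg i k + a ≠ R.deg i l)
    (φ : ∀ i, (R'.ι i → MvPolynomial (Fin n) K) →ₗ[MvPolynomial (Fin n) K]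
        (R.ι i → MvPolynomial (Fin n) K))
    (hφd : ∀ i k, IsHomogeneousVec (R.deg i) (R'.deg i k + a) (φ i (Pi.single k 1)))
    (hφ₀ : ∀ x, R.aug (φ 0 x) = u * R'.aug x)
    (hφ : ∀ i x, R.diff i (φ (i + 1) x) = φ i (R'.diff i x)) :
    GradedRes (I ⊔ Ideal.span {u}) where
  ι := coneIndex R R'
  deg := coneDeg R R' a
  aug := coneAug R.aug u
  diff := coneDiff R R' φ
  aug_homogeneous := by
    rintro (k | k)
    · have h : coneAug R.aug u (Pi.single (Sum.inl k) 1) = _ := coneAug_single_inl R.aug u k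
      exact Eq.subst (motive := fun f => f.IsHomogeneous (R.deg 0 k)) h.symm (R.aug_homogeneous k)
    · have h : coneAug R.aug u (Pi.single (Sum.inr k) 1) = _ := coneAug_single_inr R.aug u k
      exact Eq.subst (motive := fun f => f.IsHomogeneous a) h.symm hu
  diff_homogeneous
    | 0 => isHomogeneousVec_coneMap (R.diff_homogeneous 0) (hφd 0) fun k _ m hm => by
        have := R'.aug_homogeneous k (mem_support_iff.1 hm)
        rw [Finsupp.degree_eq_weight_one]
        exact congrArg (· + a) this
    | i + 1 => isHomogeneousVec_coneMap (R.diff_homogeneous (i + 1)) (hφd (i + 1)) fun k l m hm => by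
        have := R'.diff_homogeneous i k l m hm
        omega
  range_aug := R.range_coneAug u
  exact_aug := R.exact_coneAug R' hL (φ 0) hφ₀
  exact_diff
    | 0 => exact_coneMap (R.exact_diff 0) (fun y => by
        rw [← R'.exact_aug y]
        exact ⟨fun h => congrFun h (), fun h => funext fun _ => h⟩) (hφ 0)
    | i + 1 => exact_coneMap (R.exact_diff (i + 1)) (R'.exact_diff i) (hφ (i + 1))
  -- A constant entry of φ would join basis elements of equal degree, against `hd`; a constant entry
  -- of the augmentation of `R'` would come from a basis element of degree 0, against `hR`.
  minimal
    | 0 => constantCoeff_coneMap (R.minimal 0)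
        (fun k l => by
          by_contra h
          have := hφd 0 k l 0 (mem_support_iff.2 h)
          simp only [map_zero, zero_add] at this
          exact hd 0 k l this.symm)
        (fun k l => by
          by_contra h
          have := R'.aug_homogeneous k h
          rw [map_zero] at this
          exact hR k this.symm)
    | i + 1 => constantCoeff_coneMap (R.minimal (i + 1))
        (fun k l => by
          by_contra h
          have := hφd (i + 1) k l 0 (mem_support_iff.2 h)
          simp only [map_zero, zero_add] at this
          exact hd (i + 1) k l this.symm)
        (R'.minimal i)

end GradedRes

/-- `I` has a minimal graded free resolution with graded Betti numbers `b`. -/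
def HasBetti {K : Type*} [Field K] {n : ℕ} (I : Ideal (MvPolynomial (Fin n) K))
    (b : ℕ → ℕ → ℕ) : Prop :=
  ∃ R : GradedRes I, ∀ i m, R.betti i m = b i m

/-! ### Betti tables under adding one generator -/

section HasBetti

variable {K : Type*} [Field K] {n : ℕ} {I L : Ideal (MvPolynomial (Fin n) K)} {b b' : ℕ → ℕ → ℕ}

theorem HasBetti.nonempty (h : HasBetti I b) : Nonempty (MinimalGradedFreeResolution I) :=
  ⟨h.choose.toResolution⟩

theorem HasBetti.betti_eq (h : HasBetti I b) (F : MinimalGradedFreeResolution I) (i m : ℕ) :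
    F.betti i m = b i m := by
  rw [← GradedRes.betti_ofResolution, ← h.choose_spec]
  exact GradedRes.betti_eq _ _ _ _

theorem hasBetti_bot : HasBetti (⊥ : Ideal (MvPolynomial (Fin n) K)) (fun _ _ => 0) :=
  ⟨{ ι := fun _ => Empty
     deg := fun _ k => k.elim
     aug := 0
     diff := fun _ => 0
     aug_homogeneous := fun k => k.elim
     diff_homogeneous := fun _ k => k.elim
     range_aug := LinearMap.range_zero
     exact_aug := fun _ => ⟨fun _ => ⟨0, Subsingleton.elim _ _⟩, fun _ => rfl⟩
     exact_diff := fun _ _ => ⟨fun _ => ⟨0, Subsingleton.elim _ _⟩, fun _ => rfl⟩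
     minimal := fun _ k => k.elim }, fun _ _ => rfl⟩

theorem card_filter_sum {ι κ : Type*} [Fintype ι] [Fintype κ] (p : ι ⊕ κ → Prop)
    [DecidablePred p] :
    (Finset.univ.filter p).card = (Finset.univ.filter fun k => p (Sum.inl k)).card +
      (Finset.univ.filter fun k => p (Sum.inr k)).card := by
  simp only [Finset.card_filter, Fintype.sum_sum_type]

/-- Betti numbers of `I + (u)` by the mapping cone construction, where `L = I : u`. -/
theorem HasBetti.sup_span (hb : HasBetti I b) (hb' : HasBetti L b') {u : MvPolynomial (Fin n) K}
    {a : ℕ} (hu : u.IsHomogeneous a) (hL : ∀ f, f * u ∈ I ↔ f ∈ L) (h0 : b' 0 0 = 0)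
    (hd : ∀ i m, b' i m ≠ 0 → b i (m + a) = 0) :
    HasBetti (I ⊔ Ideal.span {u}) (fun i m => b i m +
      match i with
      | 0 => if m = a then 1 else 0
      | i + 1 => if a ≤ m then b' i (m - a) else 0) := by
  obtain ⟨R, hR⟩ := hb
  obtain ⟨R', hR'⟩ := hb'
  obtain ⟨φ, hφd, hφ₀, hφ⟩ := R.exists_chainMap R' hu
    (fun f hf => by rw [mul_comm]; exact (hL f).2 hf)
  refine ⟨R.cone R' hu hL ?_ ?_ φ hφd hφ₀ hφ, ?_⟩
  · intro k hk
    rw [← hR', GradedRes.betti, Finset.card_eq_zero] at h0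
    exact Finset.notMem_empty k (h0 ▸ Finset.mem_filter.2 ⟨Finset.mem_univ k, hk⟩)
  · intro i k l hkl
    have h1 : b' i (R'.deg i k) ≠ 0 := by
      rw [← hR', GradedRes.betti]
      exact Finset.card_ne_zero_of_mem (Finset.mem_filter.2 ⟨Finset.mem_univ k, rfl⟩)
    have h2 : b i (R.deg i l) ≠ 0 := by
      rw [← hR, GradedRes.betti]
      exact Finset.card_ne_zero_of_mem (Finset.mem_filter.2 ⟨Finset.mem_univ l, rfl⟩)
    rw [← hkl] at h2
    exact h2 (hd i _ h1)
  · rintro (_ | i) m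
    · change (Finset.univ.filter fun k : R.ι 0 ⊕ Unit =>
        Sum.elim (R.deg 0) (fun _ => a) k = m).card = _
      rw [card_filter_sum]
      congr 1
      · exact hR 0 m
      · change (Finset.univ.filter fun _ : Unit => a = m).card = _
        by_cases h : m = a
        · simp [h]
        · simp [h, Ne.symm h]
    · change (Finset.univ.filter fun k : R.ι (i + 1) ⊕ R'.ι i =>
        Sum.elim (R.deg (i + 1)) (fun k => R'.deg i k + a) k = m).card = _
      rw [card_filter_sum]
      congr 1
      · exact hR (i + 1) m
      · change (Finset.univ.filter fun k : R'.ι i => R'.deg i k + a = m).card = _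
        by_cases h : a ≤ m
        · simp only [h, if_true, ← hR', GradedRes.betti]
          congr 1
          ext k
          simp only [Finset.mem_filter, Finset.mem_univ, true_and]
          omega
        · simp only [h, if_false, Finset.card_eq_zero]
          ext k
          simp only [Finset.mem_filter, Finset.mem_univ, true_and, Finset.notMem_empty, iff_false]
          omega

end HasBetti

/-! ### Monomial ideals with linear quotients -/

section MonomialIdeal

variable {K : Type*} [Field K] {n : ℕ}

theorem mul_monomial_mem_iff (T : Set (Fin n →₀ ℕ)) (u : Fin n →₀ ℕ)
    (f : MvPolynomial (Fin n) K) :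
    f * monomial u 1 ∈ Ideal.span ((fun v => monomial v (1 : K)) '' T) ↔
      ∀ m ∈ f.support, ∃ g ∈ T, g ≤ m + u := by
  rw [mem_ideal_span_monomial_image]
  constructor
  · intro h m hm
    refine h (m + u) ?_
    rw [mem_support_iff, coeff_mul_monomial, mul_one]
    exact mem_support_iff.1 hm
  · intro h m hm
    rw [mem_support_iff, coeff_mul_monomial', mul_one] at hm
    split_ifs at hm with hu
    · have := h (m - u) (mem_support_iff.2 hm)
      rwa [tsub_add_cancel_of_le hu] at this
    · exact absurd rfl hm

theorem monomial_mem_iff (T : Set (Fin n →₀ ℕ)) (u : Fin n →₀ ℕ) :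
    monomial u (1 : K) ∈ Ideal.span ((fun v => monomial v (1 : K)) '' T) ↔ ∃ g ∈ T, g ≤ u := by
  classical
  rw [mem_ideal_span_monomial_image, support_monomial, if_neg one_ne_zero]
  simp

/-- The hypothesis `hT` says that T' generates the colon of (T) by u. It is tested on monomials
only, because membership in a monomial ideal is decided on supports. -/
theorem HasBetti.insert_monomial {T T' : Set (Fin n →₀ ℕ)} {b b' : ℕ → ℕ → ℕ} {u : Fin n →₀ ℕ}
    (hb : HasBetti (Ideal.span ((fun v => monomial v (1 : K)) '' T)) b)
    (hb' : HasBetti (Ideal.span ((fun v => monomial v (1 : K)) '' T')) b')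
    (hT : ∀ m, (∃ g ∈ T, g ≤ m + u) ↔ ∃ g ∈ T', g ≤ m) (h0 : b' 0 0 = 0)
    (hd : ∀ i m, b' i m ≠ 0 → b i (m + u.degree) = 0) :
    HasBetti (Ideal.span ((fun v => monomial v (1 : K)) '' (insert u T))) (fun i m => b i m +
      match i with
      | 0 => if m = u.degree then 1 else 0
      | i + 1 => if u.degree ≤ m then b' i (m - u.degree) else 0) := by
  have h := hb.sup_span hb' (u := monomial u 1) (isHomogeneous_monomial 1 rfl) (fun f => by
    rw [mul_monomial_mem_iff, mem_ideal_span_monomial_image]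
    simp only [hT]) h0 hd
  rw [sup_comm, ← Ideal.span_insert] at h
  rwa [Set.image_insert_eq]

theorem HasBetti.congr {I : Ideal (MvPolynomial (Fin n) K)} {b b' : ℕ → ℕ → ℕ}
    (h : HasBetti I b) (hb : ∀ i m, b i m = b' i m) : HasBetti I b' :=
  ⟨h.choose, fun i m => (h.choose_spec i m).trans (hb i m)⟩

/-- The Betti numbers of an ideal generated by variables. -/
theorem hasBetti_variables (A : Finset (Fin n)) :
    HasBetti (Ideal.span ((fun v => monomial v (1 : K)) ''
      ((fun i => Finsupp.single i 1) '' (A : Set (Fin n)))))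
      (fun i m => if m = i + 1 then A.card.choose (i + 1) else 0) := by
  classical
  induction A using Finset.induction_on with
  | empty => simpa using hasBetti_bot
  | insert a A ha ih =>
    rw [Finset.coe_insert, Set.image_insert_eq]
    -- A variable outside A is a nonzerodivisor modulo (A), so the colon ideal is (A) again and `ih`
    -- serves twice; the binomials add by Pascal's rule.
    refine (ih.insert_monomial ih ?_ rfl ?_).congr ?_
    · intro m
      simp only [Set.exists_mem_image]
      refine exists_congr fun i => and_congr_right fun hi => ?_
      have hia : a ≠ i := fun h => ha (h ▸ hi)
      simp [Finsupp.single_le_iff, Finsupp.single_eq_of_ne' hia]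
    · intro i m h
      have : m = i + 1 := by
        by_contra h'
        exact h (if_neg h')
      rw [if_neg]
      simp [this]
    · rintro (_ | i) m
      · simp only [Finset.card_insert_of_notMem ha, Finsupp.degree_single]
        split_ifs <;> simp_all
      · simp only [Finset.card_insert_of_notMem ha, Finsupp.degree_single]
        by_cases h : m = i + 1 + 1
        · subst h
          rw [if_pos rfl, if_pos rfl, if_pos (by omega), if_pos (by omega),
            Nat.choose_succ_succ _ (i + 1), add_comm]
        · rw [if_neg h, if_neg h]
          split_ifs <;> first | rfl | omega

/-- The Betti numbers of a monomial ideal with linear quotients. -/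
theorem hasBetti_of_linearQuotients {α : Type*} [LinearOrder α] (ord : (Fin n →₀ ℕ) → α)
    (A : (Fin n →₀ ℕ) → Finset (Fin n)) (G : Finset (Fin n →₀ ℕ))
    (hdeg : ∀ u ∈ G, ∀ g ∈ G, ord g ≤ ord u → g.degree ≤ u.degree)
    (hA : ∀ u ∈ G, ∀ i ∈ A u, ∃ g ∈ G, ord g < ord u ∧ g ≤ Finsupp.single i 1 + u)
    (hG : ∀ u ∈ G, ∀ g ∈ G, g ≠ u → ord g ≤ ord u → ∃ i ∈ A u, u i < g i) :
    HasBetti (Ideal.span ((fun v => monomial v (1 : K)) '' (G : Set (Fin n →₀ ℕ))))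
      (fun i m => ∑ u ∈ G, if m = i + u.degree then (A u).card.choose i else 0) := by
  classical
  -- Induction over initial segments of G. `ord` need not be injective: ties may enter in any order,
  -- because `hG` also covers them.
  suffices H : ∀ s : Finset (Fin n →₀ ℕ), s ⊆ G → (∀ u ∈ s, ∀ g ∈ G, ord g < ord u → g ∈ s) →
      HasBetti (Ideal.span ((fun v => monomial v (1 : K)) '' (s : Set (Fin n →₀ ℕ))))
      (fun i m => ∑ u ∈ s, if m = i + u.degree then (A u).card.choose i else 0) from
    H G (Finset.Subset.refl G) fun _ _ g hg _ => hg
  intro s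
  induction s using Finset.induction_on_max_value ord with
  | empty => intro _ _; simpa using hasBetti_bot
  | insert a s ha hmax ih =>
    intro hs hinit
    have haG : a ∈ G := hs (Finset.mem_insert_self a s)
    have hsG : s ⊆ G := fun x hx => hs (Finset.mem_insert_of_mem hx)
    have ih' := ih hsG fun u hu g hg hgu =>
      (Finset.mem_insert.1 (hinit u (Finset.mem_insert_of_mem hu) g hg hgu)).resolve_left
        (by rintro rfl; exact absurd (hmax u hu) (not_le.2 hgu))
    rw [Finset.coe_insert]
    refine (ih'.insert_monomial (hasBetti_variables (A a)) ?_ rfl ?_).congr ?_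
    · intro m
      simp only [Set.exists_mem_image]
      constructor
      · rintro ⟨g, hg, hgm⟩
        obtain ⟨i, hi, hlt⟩ := hG a haG g (hsG hg) (by rintro rfl; exact ha hg) (hmax g hg)
        refine ⟨i, hi, ?_⟩
        rw [Finsupp.single_le_iff]
        have := hgm i
        rw [Finsupp.add_apply] at this
        omega
      · rintro ⟨i, hi, him⟩
        obtain ⟨g, hg, hlt, hle⟩ := hA a haG i hi
        refine ⟨g, ?_, hle.trans (add_le_add him le_rfl)⟩
        exact (Finset.mem_insert.1 (hinit a (Finset.mem_insert_self a s) g hg hlt)).resolve_left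
          (by rintro rfl; exact lt_irrefl _ hlt)
    · intro i m h
      have hm : m = i + 1 := by
        by_contra h'
        exact h (if_neg h')
      -- Minimality of the cone: the shifted resolution of the colon sits in degree i + 1 + deg a,
      -- while the earlier generators contribute only degrees i + deg u ≤ i + deg a.
      refine Finset.sum_eq_zero fun u hu => if_neg ?_
      have := hdeg a haG u (hsG hu) (hmax u hu)
      omega
    · intro i m
      rw [Finset.sum_insert ha, add_comm]
      congr 1
      cases i with
      | zero => simp
      | succ i =>
        simp only
        by_cases h : m = i + 1 + a.degree
        · subst h
          simp
        · rw [if_neg h]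
          split_ifs <;> first | rfl | omega

end MonomialIdeal

/-! ### Spaced sequences and their gaps -/

section Sequences

variable {n ℓ : ℕ}

/-- The exponent vector of `x_{J_1} ⋯ x_{J_ℓ}`. -/
noncomputable def seqMonomial (J : Fin ℓ → Fin n) : Fin n →₀ ℕ := ∑ k, Finsupp.single (J k) 1

/-- Consecutive terms of `J` have distance at least `s_k`. -/
def IsSpaced (s : ℕ → ℕ) (J : Fin ℓ → Fin n) : Prop :=
  ∀ (k : ℕ) (h : k + 1 < ℓ), (J ⟨k, Nat.lt_of_succ_lt h⟩ : ℕ) + s k ≤ J ⟨k + 1, h⟩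

theorem IsSpaced.monotone {s : ℕ → ℕ} {J : Fin ℓ → Fin n} (hJ : IsSpaced s J) : Monotone J := by
  cases ℓ with
  | zero => exact fun a => a.elim0
  | succ ℓ =>
    rw [Fin.monotone_iff_le_succ]
    intro k
    have := hJ k (by omega)
    exact Fin.le_def.2 (le_trans (Nat.le_add_right _ _) this)

theorem seqMonomial_apply (J : Fin ℓ → Fin n) (i : Fin n) :
    seqMonomial J i = (Finset.univ.filter fun k => J k = i).card := by
  rw [seqMonomial, Finsupp.finsetSum_apply, Finset.card_filter]
  simp only [Finsupp.single_apply]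

theorem degree_seqMonomial (J : Fin ℓ → Fin n) : (seqMonomial J).degree = ℓ := by
  rw [seqMonomial, map_sum]
  simp

theorem seqMonomial_update (J : Fin ℓ → Fin n) (q : Fin ℓ) (i : Fin n) :
    seqMonomial (Function.update J q i) + Finsupp.single (J q) 1 =
      seqMonomial J + Finsupp.single i 1 := by
  unfold seqMonomial
  rw [← Finset.add_sum_erase _ _ (Finset.mem_univ q),
    ← Finset.add_sum_erase _ (fun k => Finsupp.single (J k) 1) (Finset.mem_univ q),
    Function.update_self, Finset.sum_congr rfl fun k hk => by
      rw [Function.update_of_ne (Finset.ne_of_mem_erase hk)]]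
  abel

theorem seqMonomial_ne_zero (J : Fin ℓ → Fin n) (q : Fin ℓ) : seqMonomial J (J q) ≠ 0 := by
  rw [seqMonomial_apply]
  exact Finset.card_ne_zero_of_mem (Finset.mem_filter.2 ⟨Finset.mem_univ q, rfl⟩)

/-- The sum of the indices of the variables of a monomial. -/
def weight (u : Fin n →₀ ℕ) : ℕ := ∑ i, u i * (i : ℕ)

theorem weight_add (u v : Fin n →₀ ℕ) : weight (u + v) = weight u + weight v := by
  simp [weight, add_mul, Finset.sum_add_distrib]

theorem weight_single (i : Fin n) : weight (Finsupp.single i 1) = i := by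
  simp [weight, Finsupp.single_apply]

theorem weight_seqMonomial (J : Fin ℓ → Fin n) : weight (seqMonomial J) = ∑ k, (J k : ℕ) := by
  unfold weight seqMonomial
  simp only [Finsupp.finsetSum_apply, Finset.sum_mul]
  rw [Finset.sum_comm]
  exact Finset.sum_congr rfl fun k _ => weight_single (J k)

theorem maxVar_seqMonomial (J : Fin (ℓ + 1) → Fin n) (hJ : Monotone J) :
    maxVar (seqMonomial J) = J (Fin.last ℓ) + 1 := by
  refine le_antisymm (Finset.sup_le fun a ha => ?_) ?_
  · rw [Finsupp.mem_support_iff, seqMonomial_apply] at ha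
    obtain ⟨k, hk⟩ := Finset.card_ne_zero.1 ha
    rw [Finset.mem_filter] at hk
    rw [← hk.2]
    exact Nat.succ_le_succ (Fin.le_def.1 (hJ (Fin.le_last k)))
  · exact Finset.le_sup (f := fun a : Fin n => (a : ℕ) + 1)
      (Finsupp.mem_support_iff.2 (seqMonomial_ne_zero J (Fin.last ℓ)))

/-- The indices `i` that can replace the first larger term `J_q` of `J`. -/
noncomputable def gapSet (s : ℕ → ℕ) (J : Fin ℓ → Fin n) : Finset (Fin n) :=
  open Classical in Finset.univ.filter fun i => ∃ q : Fin ℓ, i < J q ∧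
    ∀ (k : ℕ) (h : k + 1 < ℓ), k + 1 = q → (J ⟨k, Nat.lt_of_succ_lt h⟩ : ℕ) + s k ≤ i

theorem mem_gapSet {s : ℕ → ℕ} {J : Fin ℓ → Fin n} {i : Fin n} :
    i ∈ gapSet s J ↔ ∃ q : Fin ℓ, i < J q ∧
      ∀ (k : ℕ) (h : k + 1 < ℓ), k + 1 = q → (J ⟨k, Nat.lt_of_succ_lt h⟩ : ℕ) + s k ≤ i := by
  simp [gapSet]

-- The set is the disjoint union of [0, a 0) and the intervals [a k + s k, a (k + 1)) for k < m,
-- whose lengths telescope.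
open scoped Classical in
theorem card_gaps_add_sum (a s : ℕ → ℕ) (m : ℕ) (h : ∀ k < m, a k + s k ≤ a (k + 1)) :
    ((Finset.range (a m)).filter fun i => ∃ q ≤ m, i < a q ∧ ∀ k, k + 1 = q → a k + s k ≤ i).card +
      ∑ k ∈ Finset.range m, s k = a m := by
  induction m with
  | zero =>
    rw [Finset.filter_true_of_mem]
    · simp
    · intro i hi
      exact ⟨0, le_rfl, Finset.mem_range.1 hi, fun k hk => by omega⟩
  | succ m ih =>
    have ih' := ih fun k hk => h k (by omega)
    have hm := h m (by omega)
    have hmono : ∀ q ≤ m, a q ≤ a m := by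
      have hadd : ∀ j q, q + j ≤ m → a q ≤ a (q + j) := by
        intro j
        induction j with
        | zero => exact fun q _ => le_rfl
        | succ j ihj =>
          intro q hq
          have h1 := ihj q (by omega)
          have h2 := h (q + j) (by omega)
          rw [← add_assoc]
          omega
      intro q hq
      obtain ⟨j, rfl⟩ := Nat.exists_eq_add_of_le hq
      exact hadd j q le_rfl
    have hU : ((Finset.range (a (m + 1))).filter fun i => ∃ q ≤ m + 1, i < a q ∧
        ∀ k, k + 1 = q → a k + s k ≤ i) =
        ((Finset.range (a m)).filter fun i => ∃ q ≤ m, i < a q ∧ ∀ k, k + 1 = q → a k + s k ≤ i) ∪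
          Finset.Ico (a m + s m) (a (m + 1)) := by
      ext i
      simp only [Finset.mem_filter, Finset.mem_range, Finset.mem_union, Finset.mem_Ico]
      constructor
      · rintro ⟨hi, q, hq, hiq, hk⟩
        rcases Nat.lt_or_ge m q with hmq | hmq
        · obtain rfl : q = m + 1 := by omega
          exact Or.inr ⟨hk m rfl, hi⟩
        · exact Or.inl ⟨hiq.trans_le (hmono q hmq), q, hmq, hiq, hk⟩
      · rintro (⟨hi, q, hq, hiq, hk⟩ | ⟨h1, h2⟩)
        · exact ⟨by omega, q, by omega, hiq, hk⟩
        · exact ⟨h2, m + 1, le_rfl, h2, fun k hk => by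
            obtain rfl : k = m := by omega
            exact h1⟩
    rw [hU, Finset.card_union_of_disjoint, Nat.card_Ico, Finset.sum_range_succ]
    · omega
    · rw [Finset.disjoint_left]
      intro i hi hi'
      rw [Finset.mem_filter, Finset.mem_range] at hi
      rw [Finset.mem_Ico] at hi'
      omega

theorem card_gapSet {s : ℕ → ℕ} {J : Fin ℓ → Fin n} (hJ : IsSpaced s J) :
    (gapSet s J).card = maxVar (seqMonomial J) - 1 - ∑ k ∈ Finset.range (ℓ - 1), s k := by
  classical
  cases ℓ with
  | zero =>
    -- The monomial 1, which occurs when I = S: `maxVar` is 0, and truncated subtraction gives 0. In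
    -- the other case no truncation takes place.
    have h1 : gapSet s J = ∅ := by
      ext i
      rw [mem_gapSet]
      simp
    have h2 : seqMonomial J = 0 := by simp [seqMonomial]
    simp [h1, h2, maxVar]
  | succ m =>
    let a : ℕ → ℕ := fun k => if h : k < m + 1 then J ⟨k, h⟩ else 0
    have ha : ∀ k (h : k < m + 1), a k = J ⟨k, h⟩ := fun k h => dif_pos h
    have h := card_gaps_add_sum a s m fun k hk => by
      rw [ha k (by omega), ha (k + 1) (by omega)]
      exact hJ k (by omega)
    rw [maxVar_seqMonomial J hJ.monotone]
    have hlast : a m = J (Fin.last m) := ha m (by omega)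
    have hcard : (gapSet s J).card = ((Finset.range (a m)).filter fun i => ∃ q ≤ m, i < a q ∧
        ∀ k, k + 1 = q → a k + s k ≤ i).card := by
      rw [← Finset.card_map Fin.valEmbedding]
      congr 1
      ext i
      simp only [Finset.mem_map, Finset.mem_filter, Finset.mem_range, mem_gapSet,
        Fin.valEmbedding_apply]
      constructor
      · rintro ⟨i, ⟨q, hq, hk⟩, rfl⟩
        refine ⟨?_, q, by omega, ?_, ?_⟩
        · rw [hlast]
          exact Fin.lt_def.1 (hq.trans_le (hJ.monotone (Fin.le_last q)))
        · rw [ha q q.2]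
          exact hq
        · intro k hkq
          rw [ha k (by omega)]
          exact hk k (by omega) hkq
      · rintro ⟨hi, q, hq, hiq, hk⟩
        rw [hlast] at hi
        rw [ha q (by omega)] at hiq
        refine ⟨⟨i, hi.trans (J (Fin.last m)).2⟩, ⟨⟨q, by omega⟩, hiq, ?_⟩, rfl⟩
        intro k hkm hkq
        have := hk k hkq
        rwa [ha k (by omega)] at this
    simp only [add_tsub_cancel_right]
    omega

theorem IsSpaced.update {s : ℕ → ℕ} {J : Fin ℓ → Fin n} (hJ : IsSpaced s J) {q : Fin ℓ} {i : Fin n}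
    (hi : i ≤ J q)
    (hq : ∀ (k : ℕ) (h : k + 1 < ℓ), k + 1 = q → (J ⟨k, Nat.lt_of_succ_lt h⟩ : ℕ) + s k ≤ i) :
    IsSpaced s (Function.update J q i) := by
  intro k h
  have hk := hJ k h
  by_cases h1 : k = q
  · have e1 : (⟨k, Nat.lt_of_succ_lt h⟩ : Fin ℓ) = q := Fin.ext h1
    have e2 : (⟨k + 1, h⟩ : Fin ℓ) ≠ q := fun e => by
      have := congrArg Fin.val e
      simp only at this
      omega
    rw [e1] at hk ⊢
    rw [Function.update_self, Function.update_of_ne e2]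
    have := Fin.le_def.1 hi
    omega
  · have e1 : (⟨k, Nat.lt_of_succ_lt h⟩ : Fin ℓ) ≠ q := fun e => h1 (congrArg Fin.val e)
    rw [Function.update_of_ne e1]
    by_cases h2 : k + 1 = q
    · have e2 : (⟨k + 1, h⟩ : Fin ℓ) = q := Fin.ext h2
      rw [e2, Function.update_self]
      exact hq k h h2
    · rw [Function.update_of_ne fun e => h2 (congrArg Fin.val e)]
      exact hk

/-- If `J'` falls below `J` somewhere, then the first such term lies in a gap of `J` and occurs
more often in `J'`. -/
theorem exists_mem_gapSet {s : ℕ → ℕ} {p : ℕ} {J : Fin ℓ → Fin n} {J' : Fin p → Fin n}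
    (hJ : IsSpaced s J) (hJ' : IsSpaced s J') (hp : p ≤ ℓ)
    (h : ∃ q : Fin p, J' q < J (Fin.castLE hp q)) :
    ∃ i ∈ gapSet s J, seqMonomial J i < seqMonomial J' i := by
  classical
  obtain ⟨q, hq, hmin⟩ := exists_minimal_of_wellFoundedLT
    (fun q : Fin p => J' q < J (Fin.castLE hp q)) h
  have hlt : ∀ k : Fin p, k < q → J (Fin.castLE hp k) ≤ J' k := fun k hk => by
    by_contra h'
    exact absurd (hmin (not_le.1 h') hk.le) (not_le.2 hk)
  -- Before q the terms of J' are at least those of J, so the spacing of J' just before q gives the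
  -- lower bound required by the gap of J.
  refine ⟨J' q, mem_gapSet.2 ⟨Fin.castLE hp q, hq, fun k hk hkq => ?_⟩, ?_⟩
  · rw [Fin.val_castLE] at hkq
    have h1 := hJ' k (by omega)
    have h2 := Fin.le_def.1 (hlt ⟨k, by omega⟩ (Fin.lt_def.2 (by simp only; omega)))
    have h3 : (⟨k + 1, by omega⟩ : Fin p) = q := Fin.ext hkq
    rw [h3] at h1
    simp only [Fin.castLE_mk] at h2
    omega
  · rw [seqMonomial_apply, seqMonomial_apply, ← Finset.card_map Fin.valEmbedding,
      ← Finset.card_map (s := Finset.univ.filter fun k => J' k = J' q) Fin.valEmbedding]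
    -- Where J takes the value J' q the position k precedes q, and J k ≤ J' k ≤ J' q forces J' k =
    -- J' q. The position q itself is extra.
    refine Finset.card_lt_card (Finset.ssubset_iff_subset_ne.2 ⟨?_, ?_⟩)
    · intro k hk
      simp only [Finset.mem_map, Finset.mem_filter, Finset.mem_univ, true_and,
        Fin.valEmbedding_apply] at hk ⊢
      obtain ⟨k, hk, rfl⟩ := hk
      have hkq : k < Fin.castLE hp q := by
        by_contra h'
        have := hJ.monotone (not_lt.1 h')
        rw [hk] at this
        exact absurd hq (not_lt.2 this)
      have hkq' : (k : ℕ) < q := hkq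
      refine ⟨⟨k, by omega⟩, le_antisymm (hJ'.monotone (Fin.le_def.2 hkq'.le)) ?_, rfl⟩
      rw [← hk]
      exact hlt ⟨k, by omega⟩ hkq'
    · intro heq
      have h1 : (q : ℕ) ∈ (Finset.univ.filter fun k => J' k = J' q).map Fin.valEmbedding := by
        simp only [Finset.mem_map, Finset.mem_filter, Finset.mem_univ, true_and,
          Fin.valEmbedding_apply]
        exact ⟨q, rfl, rfl⟩
      rw [← heq] at h1
      simp only [Finset.mem_map, Finset.mem_filter, Finset.mem_univ, true_and,
        Fin.valEmbedding_apply] at h1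
      obtain ⟨k, hk, hkq⟩ := h1
      have : k = Fin.castLE hp q := Fin.ext hkq
      rw [← this, hk] at hq
      exact lt_irrefl _ hq

/-- A set of sequences closed under the lowering of single terms is closed under lowering. -/
theorem mem_of_le {s : ℕ → ℕ} (P : (Fin ℓ → Fin n) → Prop)
    (hP : ∀ J q i, IsSpaced s J → P J → i < J q → IsSpaced s (Function.update J q i) →
      P (Function.update J q i))
    {J J' : Fin ℓ → Fin n} (hJ : IsSpaced s J) (hJ' : IsSpaced s J') (hle : J ≤ J') (h : P J') :
    P J := by
  -- The first c terms come from J, the others from J'. Lowering from left to right keeps every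
  -- intermediate sequence spaced.
  let M : ℕ → Fin ℓ → Fin n := fun c k => if (k : ℕ) < c then J k else J' k
  have hJM : ∀ c, J ≤ M c := fun c k => by
    simp only [M]
    split_ifs
    · exact le_rfl
    · exact hle k
  have hstep : ∀ c (hc : c < ℓ), M (c + 1) = Function.update (M c) ⟨c, hc⟩ (J ⟨c, hc⟩) := by
    intro c hc
    ext1 k
    by_cases hk : k = ⟨c, hc⟩
    · subst hk
      simp [M]
    · have : (k : ℕ) ≠ c := fun h => hk (Fin.ext h)
      rw [Function.update_of_ne hk]
      simp only [M, Nat.lt_succ_iff_lt_or_eq, this, or_false]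
  have H : ∀ c ≤ ℓ, IsSpaced s (M c) ∧ P (M c) := by
    intro c
    induction c with
    | zero =>
      intro _
      have : M 0 = J' := by
        ext1 k
        simp [M]
      rw [this]
      exact ⟨hJ', h⟩
    | succ c ih =>
      intro hc
      obtain ⟨h1, h2⟩ := ih (by omega)
      have h3 : IsSpaced s (M (c + 1)) := by
        rw [hstep c (by omega)]
        refine h1.update (hJM c _) fun k hk hkc => ?_
        simp only at hkc
        subst hkc
        simp only [M, Nat.lt_succ_self, if_true]
        exact hJ k hk
      refine ⟨h3, ?_⟩
      rcases (hJM c ⟨c, hc⟩).lt_or_eq with hlt | heq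
      · rw [hstep c (by omega)] at h3 ⊢
        exact hP _ _ _ h1 h2 hlt h3
      · rw [hstep c (by omega), heq, Function.update_eq_self]
        exact h2
  have hM : M ℓ = J := by
    ext1 k
    simp [M]
  rw [← hM]
  exact (H ℓ le_rfl).2

theorem seqMonomial_castLE_le {p : ℕ} (J : Fin ℓ → Fin n) (hp : p ≤ ℓ) :
    seqMonomial (J ∘ Fin.castLE hp) ≤ seqMonomial J := by
  intro i
  rw [seqMonomial_apply, seqMonomial_apply]
  refine Finset.card_le_card_of_injOn (Fin.castLE hp) ?_ (Fin.castLE_injective hp).injOn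
  intro k hk
  simpa using hk

end Sequences

/-! ### Linear quotients of spread strongly stable ideals -/

section Spread

variable {K : Type*} [Field K] {n d : ℕ} {t : Fin (d - 1) → ℕ} {I : Ideal (MvPolynomial (Fin n) K)}

/-- The entries of `t`, extended by zero. -/
def gap (t : Fin (d - 1) → ℕ) (k : ℕ) : ℕ := if h : k < d - 1 then t ⟨k, h⟩ else 0

theorem partialSum_eq (t : Fin (d - 1) → ℕ) (j : ℕ) :
    partialSum t j = ∑ k ∈ Finset.range (j - 1), gap t k := by
  have h1 : partialSum t j = ∑ k : Fin (d - 1), if (k : ℕ) + 1 < j then gap t k else 0 := by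
    rw [partialSum, Finset.sum_filter]
    refine Finset.sum_congr rfl fun k _ => ?_
    rw [gap, dif_pos k.2]
  have h2 : ∑ k ∈ Finset.range (j - 1), gap t k =
      ∑ k ∈ (Finset.range (j - 1)).filter (· < d - 1), gap t k := by
    rw [Finset.sum_filter_of_ne]
    intro k _ hk
    by_contra h
    exact hk (dif_neg h)
  rw [h1, h2, Fin.sum_univ_eq_sum_range (fun k => if k + 1 < j then gap t k else 0),
    ← Finset.sum_filter]
  refine Finset.sum_congr ?_ fun _ _ => rfl
  ext k
  simp only [Finset.mem_filter, Finset.mem_range]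
  omega

theorem isSpread_iff {u : Fin n →₀ ℕ} : IsSpread t u ↔
    ∃ (ℓ : ℕ) (J : Fin ℓ → Fin n), u = seqMonomial J ∧ ℓ ≤ d ∧ IsSpaced (gap t) J := by
  constructor
  · rintro ⟨ℓ, J, -, hu, hd, hJ⟩
    refine ⟨ℓ, J, hu, hd, fun k hk => ?_⟩
    have := hJ ⟨k, by omega⟩ hk
    rwa [gap, dif_pos (by omega)]
  · rintro ⟨ℓ, J, hu, hd, hJ⟩
    refine ⟨ℓ, J, hJ.monotone, hu, hd, fun k hk => ?_⟩
    have := hJ k hk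
    rwa [gap, dif_pos k.2] at this

theorem exists_minGens_le {u : Fin n →₀ ℕ} (h : monomial u (1 : K) ∈ I) :
    ∃ g ∈ minGens I, g ≤ u := by
  obtain ⟨g, hg, hmin⟩ :=
    exists_minimal_le_of_wellFoundedLT (fun v => monomial v (1 : K) ∈ I) u h
  exact ⟨g, hmin, hg⟩

/-- A minimal generator is divisible by a member of the given spread generating set, and by
minimality equals it. -/
theorem IsSpreadIdeal.isSpread_of_mem_minGens (hI : IsSpreadIdeal t I) {u : Fin n →₀ ℕ}
    (hu : u ∈ minGens I) : IsSpread t u := by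
  obtain ⟨A, hA, rfl⟩ := hI
  obtain ⟨a, ha, hau⟩ := (monomial_mem_iff A u).1 hu.1
  have : u = a := le_antisymm (hu.2 ((monomial_mem_iff A a).2 ⟨a, ha, le_rfl⟩) hau) hau
  rw [this]
  exact hA a ha

theorem IsSpreadIdeal.eq_span_minGens (hI : IsSpreadIdeal t I) :
    I = Ideal.span ((fun u => monomial u (1 : K)) '' minGens I) := by
  refine le_antisymm ?_ (Ideal.span_le.2 ?_)
  · obtain ⟨A, hA, h⟩ := hI
    conv_lhs => rw [h]
    refine Ideal.span_le.2 ?_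
    rintro _ ⟨a, ha, rfl⟩
    refine (monomial_mem_iff _ a).2 (exists_minGens_le ?_)
    rw [h]
    exact Ideal.subset_span ⟨a, ha, rfl⟩
  · rintro _ ⟨u, hu, rfl⟩
    exact hu.1

theorem eq_of_le_of_degree_eq {u v : Fin n →₀ ℕ} (h : u ≤ v) (hd : u.degree = v.degree) :
    u = v := by
  obtain ⟨w, rfl⟩ := exists_add_of_le h
  rw [map_add] at hd
  have : w = 0 := (Finsupp.degree_eq_zero_iff w).1 (by omega)
  rw [this, add_zero]

/-- The exchange property in terms of sequences: changing the term J q to i multiplies the monomial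
by x_i and divides it by x_{J q}. -/
theorem IsSpreadStronglyStable.update_mem (hI : IsSpreadStronglyStable t I) {ℓ : ℕ} (hℓ : ℓ ≤ d)
    {J : Fin ℓ → Fin n} {q : Fin ℓ} {i : Fin n} (hJ : IsSpaced (gap t) J)
    (hmem : monomial (seqMonomial J) (1 : K) ∈ I) (hi : i < J q)
    (hJ' : IsSpaced (gap t) (Function.update J q i)) :
    monomial (seqMonomial (Function.update J q i)) (1 : K) ∈ I := by
  have h : seqMonomial (Function.update J q i) =
      seqMonomial J - Finsupp.single (J q) 1 + Finsupp.single i 1 := by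
    rw [tsub_add_eq_add_tsub, ← seqMonomial_update, add_tsub_cancel_right]
    rw [Finsupp.single_le_iff]
    exact Nat.one_le_iff_ne_zero.2 (seqMonomial_ne_zero J q)
  rw [h]
  refine hI.stable _ (isSpread_iff.2 ⟨ℓ, J, rfl, hℓ, hJ⟩) hmem (J q) i hi
    (seqMonomial_ne_zero J q) ?_
  rw [← h]
  exact isSpread_iff.2 ⟨ℓ, _, rfl, hℓ, hJ'⟩

/-- Generators are compared by degree, then by the sum of the indices of their variables. -/
noncomputable def genOrder (u : Fin n →₀ ℕ) : ℕ ×ₗ ℕ := toLex (u.degree, weight u)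

theorem IsSpreadStronglyStable.exists_linearQuotient (hI : IsSpreadStronglyStable t I)
    {u : Fin n →₀ ℕ} (hu : u ∈ minGens I) :
    ∃ A : Finset (Fin n), A.card = maxVar u - 1 - partialSum t u.degree ∧
      (∀ i ∈ A, ∃ g ∈ minGens I, genOrder g < genOrder u ∧ g ≤ Finsupp.single i 1 + u) ∧
      ∀ g ∈ minGens I, g ≠ u → genOrder g ≤ genOrder u → ∃ i ∈ A, u i < g i := by
  obtain ⟨ℓ, J, rfl, hℓ, hJ⟩ := isSpread_iff.1 (hI.isSpreadIdeal.isSpread_of_mem_minGens hu)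
  refine ⟨gapSet (gap t) J, ?_, fun i hi => ?_, fun g hg hgu hord => ?_⟩
  · rw [card_gapSet hJ, degree_seqMonomial, partialSum_eq]
  · obtain ⟨q, hiq, hq⟩ := mem_gapSet.1 hi
    have hv := hI.update_mem hℓ hJ hu.1 hiq (hJ.update hiq.le hq)
    have hupd := seqMonomial_update J q i
    obtain ⟨g, hg, hgv⟩ := exists_minGens_le hv
    refine ⟨g, hg, ?_, ?_⟩
    · have hdeg : g.degree ≤ ℓ := (Finsupp.degree_mono hgv).trans (degree_seqMonomial _).le
      rw [genOrder, genOrder, Prod.Lex.toLex_lt_toLex, degree_seqMonomial]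
      rcases hdeg.lt_or_eq with h | h
      · exact Or.inl h
      · refine Or.inr ⟨h, ?_⟩
        rw [eq_of_le_of_degree_eq hgv (h.trans (degree_seqMonomial _).symm)]
        have := congrArg weight hupd
        rw [weight_add, weight_add, weight_single, weight_single] at this
        have := Fin.lt_def.1 hiq
        simp only
        omega
    · rw [add_comm, ← hupd]
      exact hgv.trans (le_add_of_nonneg_right zero_le)
  · obtain ⟨p, J', rfl, hp, hJ'⟩ :=
      isSpread_iff.1 (hI.isSpreadIdeal.isSpread_of_mem_minGens hg)
    rw [genOrder, genOrder, Prod.Lex.toLex_le_toLex, degree_seqMonomial, degree_seqMonomial] at hord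
    simp only at hord
    have hpℓ : p ≤ ℓ := by omega
    by_contra hcon
    have hle : ∀ q, J (Fin.castLE hpℓ q) ≤ J' q := by
      by_contra h
      push Not at h
      exact hcon (exists_mem_gapSet hJ hJ' hpℓ h)
    -- Lowering g termwise reaches the prefix of u of length p, which therefore lies in I;
    -- minimality of u then gives p = ℓ.
    have hpre : monomial (seqMonomial (J ∘ Fin.castLE hpℓ)) (1 : K) ∈ I :=
      mem_of_le (fun J => monomial (seqMonomial J) (1 : K) ∈ I)
        (fun J q i h1 h2 h3 h4 => hI.update_mem hp h1 h2 h3 h4)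
        (fun k hk => hJ k (hk.trans_le hpℓ)) hJ' hle hg.1
    have hdeg := Finsupp.degree_mono (hu.2 hpre (seqMonomial_castLE_le J hpℓ))
    rw [degree_seqMonomial, degree_seqMonomial] at hdeg
    obtain rfl : p = ℓ := le_antisymm hpℓ hdeg
    have hw : weight (seqMonomial J') ≤ weight (seqMonomial J) := by omega
    rw [weight_seqMonomial, weight_seqMonomial] at hw
    have hle' : ∀ q ∈ Finset.univ, (J q : ℕ) ≤ J' q := fun q _ => Fin.le_def.1 (hle q)
    -- J ≤ J' termwise, while the order bounds the sum of J' by that of J, so all terms agree.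
    have heq := (Finset.sum_eq_sum_iff_of_le hle').1 (le_antisymm (Finset.sum_le_sum hle') hw)
    have : J' = J := funext fun q => Fin.ext (heq q (Finset.mem_univ q)).symm
    exact hgu (by rw [this])

/-- The graded Betti numbers of a `t`-spread strongly stable ideal. -/
theorem IsSpreadStronglyStable.hasBetti (hI : IsSpreadStronglyStable t I) :
    ∃ b : ℕ → ℕ → ℕ, HasBetti I b ∧ ∀ i j, b i (i + j) =
      ∑ u ∈ minGensOfDegree I j, (maxVar u - 1 - partialSum t j).choose i := by
  classical
  -- Spread monomials have degree at most d, so G(I) is finite.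
  let G : Finset (Fin n →₀ ℕ) := (Finset.range (d + 1)).biUnion (minGensOfDegree I)
  have hG : ∀ u, u ∈ G ↔ u ∈ minGens I := by
    intro u
    simp only [G, Finset.mem_biUnion, Finset.mem_range, mem_minGensOfDegree]
    refine ⟨fun ⟨_, _, h, _⟩ => h, fun h => ?_⟩
    obtain ⟨ℓ, J, rfl, hℓ, -⟩ := isSpread_iff.1 (hI.isSpreadIdeal.isSpread_of_mem_minGens h)
    exact ⟨ℓ, by omega, h, degree_seqMonomial J⟩
  have hlq : ∀ u, ∃ A : Finset (Fin n), u ∈ minGens I →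
      A.card = maxVar u - 1 - partialSum t u.degree ∧
      (∀ i ∈ A, ∃ g ∈ minGens I, genOrder g < genOrder u ∧ g ≤ Finsupp.single i 1 + u) ∧
      ∀ g ∈ minGens I, g ≠ u → genOrder g ≤ genOrder u → ∃ i ∈ A, u i < g i := by
    intro u
    by_cases hu : u ∈ minGens I
    · obtain ⟨A, hA⟩ := hI.exists_linearQuotient hu
      exact ⟨A, fun _ => hA⟩
    · exact ⟨∅, fun h => absurd h hu⟩
  choose A hA using hlq
  have h := hasBetti_of_linearQuotients (K := K) genOrder A G
    (fun u _ g _ hgu => by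
      rw [genOrder, genOrder, Prod.Lex.toLex_le_toLex] at hgu
      simp only at hgu
      omega)
    (fun u hu i hi => by
      obtain ⟨g, hg, h⟩ := (hA u ((hG u).1 hu)).2.1 i hi
      exact ⟨g, (hG g).2 hg, h⟩)
    (fun u hu g hg => (hA u ((hG u).1 hu)).2.2 g ((hG g).1 hg))
  have hGs : (G : Set (Fin n →₀ ℕ)) = minGens I := Set.ext fun u => by
    rw [Finset.mem_coe, hG]
  rw [hGs, ← hI.isSpreadIdeal.eq_span_minGens] at h
  refine ⟨_, h, fun i j => ?_⟩
  rw [← Finset.sum_filter]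
  have hf : G.filter (fun u => i + j = i + u.degree) = minGensOfDegree I j := by
    ext u
    rw [Finset.mem_filter, hG, mem_minGensOfDegree, add_right_inj, eq_comm (a := j)]
  rw [hf]
  refine Finset.sum_congr rfl fun u hu => ?_
  obtain ⟨hmin, rfl⟩ := (mem_minGensOfDegree I j u).1 hu
  rw [(hA u hmin).1]

end Spread

end VectorSpread

theorem corollary2p4 {K : Type*} [Field K] {n d : ℕ} (hd : 2 ≤ d) (t : Fin (d - 1) → ℕ)
    (I : Ideal (MvPolynomial (Fin n) K)) (hI : VectorSpread.IsSpreadStronglyStable t I) :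
    Nonempty (VectorSpread.MinimalGradedFreeResolution I) ∧
    ∀ (F : VectorSpread.MinimalGradedFreeResolution I) (i j : ℕ),
      F.betti i (i + j) =
        ∑ u ∈ VectorSpread.minGensOfDegree I j,
          (VectorSpread.maxVar u - 1 - VectorSpread.partialSum t j).choose i := by
  obtain ⟨b, hb, h⟩ := hI.hasBetti
  exact ⟨hb.nonempty, fun F i j => (hb.betti_eq F i (i + j)).trans (h i j)⟩
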